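/- Let $\mathfrak{s}=\mathbb{R}^7$ with its standard basis $e_1,\dots,e_7$, the inner product making this basis orthonormal, and the $3$-form $$\varphi=e^{127}+e^{347}+e^{567}+e^{135}-e^{146}-e^{236}-e^{245}.$$ For a solvable Lie bracket $\mu$ on $\mathfrak{s}$ let $S_\mu$ be the simply connected Lie group with Lie algebra $(\mathfrak{s},\mu)$, endowed with the left-invariant $G_2$-structure defined by $\varphi$ and its associated left-invariant metric. Let $\mathrm{scal}_\mu$ and $\mathrm{Ric}_\mu$ be the scalar curvature and the Ricci operator of this metric, and let $d_\mu$ be the exterior derivative on left-invariant forms of $S_\mu$. Put $$\mathcal{S}_{closed}=\{\mu \text{ solvable}: d_\mu\varphi=0\},\qquad \mathcal{S}_{tf}=\{\mu\in\mathcal{S}_{closed}: d_\mu{*\varphi}=0\},$$ and let $\mathcal{S}_{\mathbb{R}}$ (the brackets of real type) be the set of all solvable $\mu$ such that, for every $X\in\mathfrak{s}$, either $\mathrm{ad}_\mu X$ is nilpotent or $\mathrm{ad}_\mu X$ has a complex eigenvalue that is not in $i\mathbb{R}$. The group $GL_7(\mathbb{R})$ acts on brackets by $h\cdot\mu=h\mu(h^{-1}\cdot,h^{-1}\cdot)$,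 so that $GL_7(\mathbb{R})\cdot\mu\cap\mathcal{S}_{closed}$ parametrizes the closed left-invariant $G_2$-structures on $S_\mu$. On $\mathcal{S}_{closed}\smallsetminus\mathcal{S}_{tf}$ consider $F(\mu)=\mathrm{scal}_\mu^2/|\mathrm{Ric}_\mu|^2$, and define $$n_\mu=\inf\{F(\lambda):\lambda\in (GL_7(\mathbb{R})\cdot\mu\cap\mathcal{S}_{closed})\smallsetminus\mathcal{S}_{tf}\}.$$ Then for every non-abelian $\mu\in\mathcal{S}_{closed}\cap\mathcal{S}_{\mathbb{R}}$, the set on the right is non-empty and $n_\mu>0$. -/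

import Mathlib

open scoped InnerProductSpace

noncomputable section

namespace ClosedG2

/-- The fixed `7`-dimensional real vector space `𝔰`, with its standard orthonormal basis. -/
abbrev E : Type := EuclideanSpace ℝ (Fin 7)

/-- The basis vector `e_{i+1}` (indices start at `0` here). -/
def e (i : Fin 7) : E := EuclideanSpace.single i 1

/-! ### Lie brackets on `𝔰` -/

/-- A Lie bracket on the vector space `𝔰`. -/
@[ext]
structure Bracket where
  /-- the underlying bilinear map; `μ.br x` is `ad_μ x` -/
  br : E →ₗ[ℝ] E →ₗ[ℝ] E
  self : ∀ x, br x x = 0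
  jacobi : ∀ x y z, br x (br y z) = br (br x y) z + br y (br x z)

namespace Bracket

/-- The Lie algebra `(𝔰, μ)`: a copy of `𝔰` carrying the bracket `μ`. -/
def Alg (_μ : Bracket) : Type := E

instance (μ : Bracket) : AddCommGroup μ.Alg := inferInstanceAs (AddCommGroup E)

instance (μ : Bracket) : Module ℝ μ.Alg := inferInstanceAs (Module ℝ E)

instance (μ : Bracket) : LieRing μ.Alg where
  bracket x y := μ.br x y
  add_lie x y z := LinearMap.congr_fun (μ.br.map_add x y) z
  lie_add x y z := map_add (μ.br x) y z
  lie_self x := μ.self x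
  leibniz_lie x y z := μ.jacobi x y z

instance (μ : Bracket) : LieAlgebra ℝ μ.Alg where
  lie_smul t x y := map_smul (μ.br x) t y

/-- `ad_μ x = μ(x, ·)`. -/
def ad (μ : Bracket) (x : E) : Module.End ℝ E := μ.br x

/-- The action of `GL(𝔰)` on brackets: `(h · μ)(x, y) = h μ(h⁻¹ x, h⁻¹ y)`. -/
def act (h : E ≃ₗ[ℝ] E) (μ : Bracket) : Bracket where
  br := (μ.br.compl₁₂ h.symm.toLinearMap h.symm.toLinearMap).compr₂ h.toLinearMap
  self x := by simp [μ.self]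
  jacobi x y z := by
    simp only [LinearMap.compr₂_apply, LinearMap.compl₁₂_apply, LinearEquiv.coe_coe,
      LinearEquiv.symm_apply_apply]
    rw [μ.jacobi, map_add]

/-- The orbit `GL(𝔰) · μ`, i.e. the isomorphism class of `μ`. -/
def orbit (μ : Bracket) : Set Bracket := {ν | ∃ h : E ≃ₗ[ℝ] E, ν = μ.act h}

/-! ### Curvature of the left-invariant metric on `S_μ` defined by the inner product -/

/-- The Levi-Civita connection on left-invariant vector fields, given by the Koszul formula
`2⟨∇_x y, z⟩ = ⟨[x, y], z⟩ - ⟨[y, z], x⟩ + ⟨[z, x], y⟩`. -/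
def nabla (μ : Bracket) (x y : E) : E :=
  ∑ k, ((1 / 2 : ℝ) * (⟪μ.br x y, e k⟫_ℝ - ⟪μ.br y (e k), x⟫_ℝ + ⟪μ.br (e k) x, y⟫_ℝ)) • e k

/-- The Riemann curvature tensor `R(x, y)z = ∇_x ∇_y z - ∇_y ∇_x z - ∇_[x,y] z`. -/
def riem (μ : Bracket) (x y z : E) : E :=
  μ.nabla x (μ.nabla y z) - μ.nabla y (μ.nabla x z) - μ.nabla (μ.br x y) z

/-- The Ricci tensor `Ric(y, z) = tr (x ↦ R(x, y)z)`. -/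
def ric (μ : Bracket) (y z : E) : ℝ := ∑ i, ⟪μ.riem (e i) y z, e i⟫_ℝ

/-- The scalar curvature. -/
def scal (μ : Bracket) : ℝ := ∑ i, μ.ric (e i) (e i)

/-- The squared norm `|Ric_μ|²` of the Ricci operator. -/
def ricNormSq (μ : Bracket) : ℝ := ∑ i, ∑ j, μ.ric (e i) (e j) ^ 2

/-- The Ricci pinching functional `F(μ) = scal_μ² / |Ric_μ|²`. -/
def F (μ : Bracket) : ℝ := μ.scal ^ 2 / μ.ricNormSq

/-- The exterior derivative `d_μ` on left-invariant forms (the Chevalley-Eilenberg differential):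
`dω(v_0, …, v_{k+1}) = ∑_{i<j} (-1)^(i+j) ω([v_i, v_j], v_0, …, v̂_i, …, v̂_j, …, v_{k+1})`. -/
def d (μ : Bracket) {k : ℕ} (ω : E [⋀^Fin (k + 1)]→ₗ[ℝ] ℝ) (v : Fin (k + 2) → E) : ℝ :=
  ∑ j : Fin (k + 2), ∑ i : Fin (k + 1),
    if i.castSucc < j then
      (-1) ^ ((i : ℕ) + (j : ℕ)) *
        ω (Matrix.vecCons (μ.br (v i.castSucc) (v j)) (i.removeNth (j.removeNth v)))
    else 0

end Bracket

/-! ### The `G₂`-structure -/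

/-- `e^{i_1 … i_k} = e^{i_1} ∧ … ∧ e^{i_k}`, with value `det (v_a(i_b))` at `(v_1, …, v_k)`. -/
def eForm {k : ℕ} (i : Fin k → Fin 7) : E [⋀^Fin k]→ₗ[ℝ] ℝ :=
  (Matrix.detRowAlternating (R := ℝ) (n := Fin k)).compLinearMap
    (LinearMap.pi fun b => (EuclideanSpace.proj (𝕜 := ℝ) (i b)).toLinearMap)

/-- `φ = e^{127} + e^{347} + e^{567} + e^{135} - e^{146} - e^{236} - e^{245}`
(indices are shifted by one). -/
def phi : E [⋀^Fin 3]→ₗ[ℝ] ℝ :=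
  eForm ![0, 1, 6] + eForm ![2, 3, 6] + eForm ![4, 5, 6] + eForm ![0, 2, 4]
    - eForm ![0, 3, 5] - eForm ![1, 2, 5] - eForm ![1, 3, 4]

/-- The volume form `e^{1234567}`. -/
def vol : E [⋀^Fin 7]→ₗ[ℝ] ℝ := eForm id

/-- The Hodge star on `3`-forms:
`*ω = ∑_{i<j<k} ω(e_i, e_j, e_k) vol(e_i, e_j, e_k, ·, ·, ·, ·)`. -/
def star3 (ω : E [⋀^Fin 3]→ₗ[ℝ] ℝ) : E [⋀^Fin 4]→ₗ[ℝ] ℝ :=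
  ∑ i, ∑ j, ∑ k, if i < j ∧ j < k then
    ω ![e i, e j, e k] • ((vol.curryLeft (e i)).curryLeft (e j)).curryLeft (e k) else 0

/-! ### Classes of solvable brackets -/

/-- The set of all solvable Lie brackets on `𝔰`. -/
def solvable : Set Bracket := {μ | LieAlgebra.IsSolvable μ.Alg}

/-- The solvable Lie brackets `μ` for which `φ` is closed on `S_μ`. -/
def closedG2 : Set Bracket := {μ | μ ∈ solvable ∧ ∀ v, μ.d phi v = 0}

/-- The solvable Lie brackets `μ` for which `φ` is torsion-free on `S_μ`. -/
def torsionFree : Set Bracket :=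
  {μ | μ ∈ solvable ∧ (∀ v, μ.d phi v = 0) ∧ ∀ v, μ.d (star3 phi) v = 0}

/-- The set of all complex eigenvalues of a real operator. -/
def Spec (A : Module.End ℝ E) : Set ℂ :=
  {z | Module.End.HasEigenvalue (LinearMap.baseChange ℂ A) z}

/-- The solvable Lie brackets of real type: every `ad_μ X` is nilpotent or has an eigenvalue off
the imaginary axis. -/
def realType : Set Bracket :=
  {μ | μ ∈ solvable ∧ ∀ x : E, IsNilpotent (μ.ad x) ∨ ¬ Spec (μ.ad x) ⊆ {z : ℂ | z.re = 0}}

/-- The values of `F` at the closed `G₂`-structures on `S_μ`; `F` is only considered off the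
torsion-free ones, where its denominator does not vanish. -/
def pinchingValues (μ : Bracket) : Set ℝ :=
  Bracket.F '' ((μ.orbit ∩ closedG2) \ torsionFree)

/-- `n_μ`, the infimum of `F` over all closed `G₂`-structures on `S_μ`. -/
def nInf (μ : Bracket) : ℝ := sInf (pinchingValues μ)

end ClosedG2

end

/-! For a left-invariant metric, `scal = -|μ|²/4 - (1/2) ∑ tr (ad e_i)² - |H|²`. If the trace form
were never negative, this would bound `|μ|²` by `-4 scal`; purely imaginary eigenvalues are what can
spoil it. Real type repairs this. By Lie's theorem the eigenvalues of `ad x` are linear functionals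
of `x`, the weights. If all their real parts vanish at `x`, then `ad x` is nilpotent and all weights
vanish at `x`, so the weights depend linearly on their real parts. Hence `-tr (ad x)²` is at most
`C` times the square of the largest real part, with `C` depending only on the isomorphism class.

Those real parts are bounded in turn by the symmetric part of `ad x` on the derived algebra, a
quantity that `-scal` controls. The result is `|ν|² ≤ K (-scal ν)` for all solvable `ν` in the orbit
(`normSq_le_scal`, `exists_normSq_le_scal`). Since Ricci curvature is quadratic in the bracket,
`|Ric|² ≤ c |ν|⁴`, and `F` is bounded below by a positive constant on the orbit (`le_F`). Closedness
plays no role in this estimate.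

The set is non-empty because `μ` itself belongs to it: a torsion-free structure has holonomy algebra
in `𝔤₂` and so zero scalar curvature, whereas the estimate gives `scal < 0` for non-abelian `μ`. -/

noncomputable section

open scoped TensorProduct

/-! ### Lie's theorem and weights over an algebraically closed field. -/

namespace LieModule

variable {k L : Type*} [Field k] [IsAlgClosed k] [CharZero k] [LieRing L] [LieAlgebra k L]
  [LieAlgebra.IsSolvable L]

/-- A solvable Lie algebra acts in triangular form in a suitable basis. -/
theorem exists_basis_triangular (n : ℕ) : ∀ (V : Type _) [AddCommGroup V] [Module k V]
    [FiniteDimensional k V] [LieRingModule L V] [LieModule k L V],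
    Module.finrank k V = n →
    ∃ b : Module.Basis (Fin n) k V, ∀ (x : L) (i j : Fin n), i < j → b.repr ⁅x, b j⁆ i = 0 := by
  induction n with
  | zero =>
    intro V _ _ _ _ _ hV
    exact ⟨Module.finBasisOfFinrankEq k V hV, fun x i => i.elim0⟩
  | succ n ih =>
    intro V _ _ _ _ _ hV
    have : Nontrivial V := Module.nontrivial_of_finrank_pos (R := k) (by omega)
    -- A common eigenvector is taken in the dual, so that its kernel is an invariant hyperplane;
    -- induction on that hyperplane gives lower triangular matrices.
    obtain ⟨χ, hχ⟩ := exists_nontrivial_weightSpace_of_isSolvable k L (Module.Dual k V)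
    obtain ⟨⟨f, hf⟩, hf0⟩ := exists_ne (0 : weightSpace (Module.Dual k V) χ)
    have hf0 : f ≠ 0 := fun h => hf0 (Subtype.ext h)
    rw [mem_weightSpace] at hf
    have hfx : ∀ x v, f ⁅x, v⁆ = - (χ x * f v) := fun x v => by
      have := LinearMap.congr_fun (hf x) v
      simp only [LinearMap.smul_apply, smul_eq_mul] at this
      rw [← this]; simp
    have hlie : ∀ (x : L) (v : V), f v = 0 → f ⁅x, v⁆ = 0 := fun x v hv => by
      rw [hfx, hv, mul_zero, neg_zero]
    let W : LieSubmodule k L V := ⟨LinearMap.ker f, fun {x v} hv => hlie x v hv⟩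
    have hmem : ∀ v, v ∈ W.toSubmodule ↔ f v = 0 := fun v => Iff.rfl
    have hW : Module.finrank k W = n := by
      have := Module.Dual.finrank_ker_add_one_of_ne_zero hf0
      have h2 : Module.finrank k (LinearMap.ker f) = Module.finrank k W := rfl
      omega
    obtain ⟨b, hb⟩ := ih W hW
    obtain ⟨y, hy⟩ : ∃ y, f y = 1 := by
      obtain ⟨v, hv⟩ : ∃ v, f v ≠ 0 := by
        by_contra! h
        exact hf0 (LinearMap.ext h)
      exact ⟨(f v)⁻¹ • v, by simp [hv]⟩
    let B : Module.Basis (Fin (n + 1)) k V := Module.Basis.mkFinCons (N := W.toSubmodule) y b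
      (fun c x hx h => by
        have h1 := congrArg f h
        rw [map_add, (hmem x).1 hx, map_smul, hy] at h1
        simpa using h1)
      (fun z => ⟨- f z, by rw [hmem]; simp [hy]⟩)
    have hB0 : B 0 = y := by simp [B, Module.Basis.coe_mkFinCons]
    have hBs : ∀ i : Fin n, B i.succ = (b i : V) := fun i => by
      simp [B, Module.Basis.coe_mkFinCons]
    refine ⟨B, fun x i j hij => ?_⟩
    obtain ⟨j, rfl⟩ := Fin.exists_succ_eq.2 (Fin.ne_zero_of_lt hij)
    have hw : ⁅x, B j.succ⁆ = ∑ l, b.repr ⁅x, b j⁆ l • B l.succ := by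
      have := congrArg (W.toSubmodule.subtype) (b.sum_repr ⁅x, b j⁆)
      simp only [map_sum, map_smul] at this
      simp only [hBs]
      exact this.symm
    rw [hw]
    simp only [map_sum, map_smul, Module.Basis.repr_self, Finsupp.coe_finsetSum,
      Finset.sum_apply, Finsupp.smul_apply, smul_eq_mul, Finsupp.single_apply]
    refine Finset.sum_eq_zero fun l _ => ?_
    split_ifs with h
    · subst h
      rw [hb x l j (by simpa using hij), zero_mul]
    · simp

/-- The diagonal entries of a triangularised action: they are linear, vanish on commutators, are
the eigenvalues, and compute the traces of squares. -/
theorem exists_weights (V : Type*) [AddCommGroup V] [Module k V]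
    [FiniteDimensional k V] [LieRingModule L V] [LieModule k L V] :
    ∃ (n : ℕ) (χ : Fin n → L →ₗ[k] k), (∀ i (x y : L), χ i ⁅x, y⁆ = 0) ∧
      (∀ x z, (toEnd k L V x).HasEigenvalue z ↔ ∃ i, z = χ i x) ∧
      ∀ x, LinearMap.trace k V (toEnd k L V x * toEnd k L V x) = ∑ i, χ i x ^ 2 := by
  obtain ⟨b, hb⟩ := exists_basis_triangular (k := k) (L := L) _ V rfl
  set M : L → Matrix _ _ k := fun x => LinearMap.toMatrix b b (toEnd k L V x) with hMdef
  have hM : ∀ x i j, M x i j = b.repr ⁅x, b j⁆ i := fun x i j => by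
    simp [hMdef, LinearMap.toMatrix_apply]
  have hlow : ∀ x i j, i < j → M x i j = 0 := fun x i j hij => by rw [hM, hb x i j hij]
  have hdiag : ∀ x y i, (M x * M y) i i = M x i i * M y i i := fun x y i => by
    rw [Matrix.mul_apply]
    refine Finset.sum_eq_single i (fun j _ hj => ?_) (by simp)
    rcases lt_or_gt_of_ne hj with h | h
    · rw [hlow y j i h, mul_zero]
    · rw [hlow x i j h, zero_mul]
  refine ⟨_, fun i => (b.coord i).comp
    ((LinearMap.applyₗ (b i)).comp (toEnd k L V : L →ₗ[k] Module.End k V)), ?_, ?_, ?_⟩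
  · intro i x y
    have h1 : M ⁅x, y⁆ = M x * M y - M y * M x := by
      simp only [hMdef, LieHom.map_lie, Ring.lie_def, map_sub, LinearMap.toMatrix_mul]
    have := congrFun (congrFun h1 i) i
    rw [Matrix.sub_apply, hdiag, hdiag, mul_comm, sub_self, hM] at this
    simpa using this
  · intro x z
    rw [Module.End.hasEigenvalue_iff_isRoot_charpoly, ← LinearMap.charpoly_toMatrix _ b,
      ← Matrix.charpoly_transpose, Matrix.charpoly_of_isUpperTriangular]
    · rw [Polynomial.isRoot_prod]
      simp only [Finset.mem_univ, true_and, Matrix.transpose_apply]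
      refine exists_congr fun i => ?_
      rw [Polynomial.root_X_sub_C]
      change M x i i = z ↔ _
      rw [hM, eq_comm]
      simp
    · intro i j hij
      exact hlow x j i hij
  · intro x
    rw [LinearMap.trace_eq_matrix_trace k b, LinearMap.toMatrix_mul, Matrix.trace]
    refine Finset.sum_congr rfl fun i _ => ?_
    rw [Matrix.diag_apply]
    change (M x * M x) i i = _
    rw [hdiag, hM, sq]
    simp

end LieModule

/-! ### Weights of the adjoint representation and the trace form. -/

namespace ClosedG2

namespace Bracket

theorem mem_Spec_iff_toEnd (μ : Bracket) (x : E) (z : ℂ) : z ∈ Spec (μ.ad x) ↔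
    (LieModule.toEnd ℂ (ℂ ⊗[ℝ] μ.Alg) (ℂ ⊗[ℝ] μ.Alg)
      (1 ⊗ₜ[ℝ] (show μ.Alg from x))).HasEigenvalue z := by
  rw [LieModule.toEnd_baseChange]
  rfl

/-- The weights of the adjoint representation of a solvable bracket. -/
theorem exists_weights {μ : Bracket} (hμ : μ ∈ solvable) :
    ∃ (n : ℕ) (χ : Fin n → E →ₗ[ℝ] ℂ), (∀ i x y, χ i (μ.br x y) = 0) ∧
      (∀ x z, z ∈ Spec (μ.ad x) ↔ ∃ i, z = χ i x) ∧
      ∀ x, ((LinearMap.trace ℝ E (μ.ad x * μ.ad x) : ℝ) : ℂ) = ∑ i, χ i x ^ 2 := by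
  have : LieAlgebra.IsSolvable μ.Alg := hμ
  have : LieAlgebra.IsSolvable (ℂ ⊗[ℝ] μ.Alg) := inferInstance
  have : FiniteDimensional ℝ μ.Alg := inferInstanceAs (FiniteDimensional ℝ E)
  have : Module.Free ℝ μ.Alg := inferInstanceAs (Module.Free ℝ E)
  obtain ⟨n, χ, h1, h2, h3⟩ := LieModule.exists_weights (k := ℂ) (L := ℂ ⊗[ℝ] μ.Alg)
    (ℂ ⊗[ℝ] μ.Alg)
  let ι : E →ₗ[ℝ] ℂ ⊗[ℝ] μ.Alg := TensorProduct.mk ℝ ℂ μ.Alg 1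
  refine ⟨n, fun i => ((χ i).restrictScalars ℝ).comp ι, fun i x y => ?_, fun x z => ?_,
    fun x => ?_⟩
  · have : ι (μ.br x y) = ⁅ι x, ι y⁆ := by
      change (1 : ℂ) ⊗ₜ[ℝ] ⁅(show μ.Alg from x), (show μ.Alg from y)⁆ =
        ⁅(1 : ℂ) ⊗ₜ[ℝ] (show μ.Alg from x), (1 : ℂ) ⊗ₜ[ℝ] (show μ.Alg from y)⁆
      rw [LieAlgebra.ExtendScalars.bracket_tmul, mul_one]
    simp only [LinearMap.comp_apply, this, LinearMap.restrictScalars_apply, h1]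
  · rw [mem_Spec_iff_toEnd, h2]
    rfl
  · have := h3 (ι x)
    simp only [LinearMap.comp_apply, LinearMap.restrictScalars_apply]
    rw [← this]
    have h4 : LieModule.toEnd ℂ (ℂ ⊗[ℝ] μ.Alg) (ℂ ⊗[ℝ] μ.Alg) (ι x) =
      (LieModule.toEnd ℝ μ.Alg μ.Alg (show μ.Alg from x)).baseChange ℂ :=
        LieModule.toEnd_baseChange ..
    rw [h4, ← LinearMap.baseChange_mul, LinearMap.trace_baseChange]
    rfl

/-- Every weight is linear and kills commutators, hence the derived algebra; the trace is the sum of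
the squared weights. -/
theorem trace_ad_sq_eq_zero {μ : Bracket} (hμ : μ ∈ solvable) {x : E}
    (hx : x ∈ Submodule.span ℝ {w | ∃ y z, w = μ.br y z}) :
    LinearMap.trace ℝ E (μ.ad x * μ.ad x) = 0 := by
  obtain ⟨n, χ, h1, -, h3⟩ := exists_weights hμ
  have h : ∀ i, χ i x = 0 := fun i => by
    have : Submodule.span ℝ {w | ∃ y z, w = μ.br y z} ≤ LinearMap.ker (χ i) := by
      rw [Submodule.span_le]
      rintro _ ⟨y, z, rfl⟩
      exact h1 i y z
    exact this hx
  have := h3 x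
  simp only [h] at this
  simpa using this

/-- For a bracket of real type the real parts of the eigenvalues of `ad x` control the
negative part of the Killing form. -/
theorem exists_trace_bound {μ : Bracket} (hμ : μ ∈ realType) :
    ∃ C : ℝ, 0 ≤ C ∧ ∀ x, ∀ r : ℝ, (∀ z ∈ Spec (μ.ad x), |z.re| ≤ r) →
      0 ≤ r → - LinearMap.trace ℝ E (μ.ad x * μ.ad x) ≤ C * r ^ 2 := by
  obtain ⟨n, χ, h1, h2, h3⟩ := exists_weights hμ.1
  let X : E →ₗ[ℝ] (Fin n → ℂ) := LinearMap.pi χ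
  let R : E →ₗ[ℝ] (Fin n → ℝ) := LinearMap.pi fun i => Complex.reLm.comp (χ i)
  -- Here real type enters: if all real parts vanish, `ad x` must be nilpotent, so the imaginary
  -- parts vanish too.
  have hker : LinearMap.ker R ≤ LinearMap.ker X := by
    intro x hx
    have hre : ∀ i, (χ i x).re = 0 := fun i => congrFun hx i
    have hnil : IsNilpotent (μ.ad x) := by
      refine (hμ.2 x).resolve_right (not_not.2 fun z hz => ?_)
      obtain ⟨i, rfl⟩ := (h2 x z).1 hz
      exact hre i
    refine funext fun i => ?_
    have hev : χ i x ∈ Spec (μ.ad x) := (h2 x _).2 ⟨i, rfl⟩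
    obtain ⟨v, hv⟩ := Module.End.HasEigenvalue.exists_hasEigenvector hev
    obtain ⟨m, hm⟩ := hnil
    have := hv.pow_apply m
    rw [← LinearMap.baseChange_pow, hm] at this
    simp only [LinearMap.baseChange_zero, LinearMap.zero_apply] at this
    exact eq_zero_of_pow_eq_zero ((smul_eq_zero.1 this.symm).resolve_right hv.2)
  -- The kernel inclusion lets `X` factor through `R`; extending the factor from the range of `R`
  -- gives a linear map whose operator norm yields the constant.
  obtain ⟨g, hg⟩ := LinearMap.exists_extend
    ((LinearMap.ker R).liftQ X hker ∘ₗ R.quotKerEquivRange.symm.toLinearMap)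
  have hgR : ∀ x, g (R x) = X x := fun x => by
    have := LinearMap.congr_fun hg ⟨R x, x, rfl⟩
    simp only [LinearMap.comp_apply, Submodule.subtype_apply] at this
    rw [this]
    have h5 : R.quotKerEquivRange.symm ⟨R x, x, rfl⟩ = Submodule.Quotient.mk x := by
      rw [LinearEquiv.symm_apply_eq]
      rfl
    simp [h5]
  let G := LinearMap.toContinuousLinearMap g
  refine ⟨n * ‖G‖ ^ 2, by positivity, fun x r hr hr0 => ?_⟩
  have hRx : ‖R x‖ ≤ r := (pi_norm_le_iff_of_nonneg hr0).2 fun i => hr _ ((h2 x _).2 ⟨i, rfl⟩)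
  have hX : ∀ i, ‖χ i x‖ ≤ ‖G‖ * r := fun i => by
    calc ‖χ i x‖ ≤ ‖X x‖ := norm_le_pi_norm (X x) i
      _ = ‖G (R x)‖ := by rw [← hgR x]; rfl
      _ ≤ ‖G‖ * ‖R x‖ := G.le_opNorm _
      _ ≤ _ := by gcongr
  have h6 : |LinearMap.trace ℝ E (μ.ad x * μ.ad x)| ≤ ∑ i : Fin n, (‖G‖ * r) ^ 2 := by
    rw [← Real.norm_eq_abs, ← Complex.norm_real, h3]
    refine (norm_sum_le _ _).trans (Finset.sum_le_sum fun i _ => ?_)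
    rw [norm_pow]
    exact pow_le_pow_left₀ (norm_nonneg _) (hX i) 2
  refine (neg_le_abs _).trans (h6.trans (le_of_eq ?_))
  simp; ring

end Bracket

/-! ### Orthonormal bases and the scalar curvature formula. -/

theorem e_eq (i : Fin 7) : e i = EuclideanSpace.basisFun (Fin 7) ℝ i := by
  simp [e]

theorem inner_e_e (i j : Fin 7) : ⟪e i, e j⟫_ℝ = if i = j then 1 else 0 := by
  rw [e_eq, e_eq]
  exact orthonormal_iff_ite.1 (EuclideanSpace.basisFun (Fin 7) ℝ).orthonormal i j

theorem sum_inner_smul_e (x : E) : ∑ k, ⟪x, e k⟫_ℝ • e k = x := by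
  simp only [e_eq, fun k => real_inner_comm (EuclideanSpace.basisFun (Fin 7) ℝ k) x]
  exact (EuclideanSpace.basisFun (Fin 7) ℝ).sum_repr' x

theorem norm_e (i : Fin 7) : ‖e i‖ = 1 := by
  rw [e_eq]; exact (EuclideanSpace.basisFun (Fin 7) ℝ).orthonormal.1 i

/-- The trace of a bilinear form does not depend on the orthonormal basis. -/
theorem sum_bilin_orthonormalBasis {ι : Type*} [Fintype ι] (b : OrthonormalBasis ι ℝ E)
    (B : E →ₗ[ℝ] E →ₗ[ℝ] ℝ) : ∑ i, B (b i) (b i) = ∑ i, B (e i) (e i) := by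
  let T : E →ₗ[ℝ] E := ∑ k, (B.flip (e k)).smulRight (e k)
  have hT : ∀ x y, ⟪x, T y⟫_ℝ = B y x := fun x y => by
    conv_rhs => rw [← sum_inner_smul_e x]
    simp [T, inner_sum, real_inner_smul_right, mul_comm]
  have h := fun {ι : Type _} [Fintype ι] (b : OrthonormalBasis ι ℝ E) =>
    T.trace_eq_sum_inner b
  simp only [hT] at h
  rw [← h b]
  simp only [e_eq]
  exact LinearMap.trace_eq_sum_inner T (EuclideanSpace.basisFun (Fin 7) ℝ) |>.trans (by simp [hT])

namespace Bracket

variable (μ : Bracket)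

theorem skew (x y : E) : μ.br x y = - μ.br y x := by
  have h := μ.self (x + y)
  simp only [map_add, LinearMap.add_apply, μ.self, zero_add, add_zero] at h
  exact eq_neg_of_add_eq_zero_right h

theorem inner_nabla (x y z : E) : ⟪μ.nabla x y, z⟫_ℝ =
    (1 / 2 : ℝ) * (⟪μ.br x y, z⟫_ℝ - ⟪μ.br y z, x⟫_ℝ + ⟪μ.br z x, y⟫_ℝ) := by
  conv_rhs => rw [← sum_inner_smul_e z]
  simp only [nabla, sum_inner, real_inner_smul_left, map_sum, map_smul, LinearMap.sum_apply,
    LinearMap.smul_apply, inner_sum, real_inner_smul_right]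
  rw [← Finset.sum_sub_distrib, ← Finset.sum_add_distrib, Finset.mul_sum]
  refine Finset.sum_congr rfl fun k _ => ?_
  rw [real_inner_comm z]
  ring

theorem inner_nabla_skew (x y z : E) : ⟪μ.nabla x y, z⟫_ℝ = - ⟪y, μ.nabla x z⟫_ℝ := by
  rw [← real_inner_comm y, inner_nabla, inner_nabla, μ.skew x y, μ.skew z y, μ.skew z x,
    inner_neg_left, inner_neg_left, inner_neg_left]
  ring

theorem nabla_sub_nabla (x y : E) : μ.nabla x y - μ.nabla y x = μ.br x y := by
  refine ext_inner_right ℝ fun z => ?_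
  rw [inner_sub_left, inner_nabla, inner_nabla, μ.skew y x, μ.skew x z, μ.skew z y,
    inner_neg_left, inner_neg_left, inner_neg_left]
  ring

/-- The Levi-Civita connection as a bilinear map. -/
def nablaHom : E →ₗ[ℝ] E →ₗ[ℝ] E :=
  LinearMap.mk₂ ℝ μ.nabla
    (fun x y z => ext_inner_right ℝ fun w => by
      simp only [inner_add_left, inner_nabla, map_add, LinearMap.add_apply, inner_add_right]
      ring)
    (fun c x y => ext_inner_right ℝ fun w => by
      simp only [real_inner_smul_left, inner_nabla, map_smul, LinearMap.smul_apply,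
        real_inner_smul_right]
      ring)
    (fun x y z => ext_inner_right ℝ fun w => by
      simp only [inner_add_left, inner_nabla, map_add, LinearMap.add_apply, inner_add_right]
      ring)
    (fun c x y => ext_inner_right ℝ fun w => by
      simp only [real_inner_smul_left, inner_nabla, map_smul, LinearMap.smul_apply,
        real_inner_smul_right]
      ring)

theorem nablaHom_apply (x y : E) : μ.nablaHom x y = μ.nabla x y := rfl

/-- The squared norm of a bracket. -/
def normSq : ℝ := ∑ i, ∑ j, ‖μ.br (e i) (e j)‖ ^ 2

/-- The trace form `tr (ad x)²`. -/
def killing (x : E) : ℝ := LinearMap.trace ℝ E (μ.ad x * μ.ad x)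

theorem killing_eq_sum {ι : Type*} [Fintype ι] (b : OrthonormalBasis ι ℝ E) (x : E) :
    μ.killing x = ∑ i, ⟪μ.br x (μ.br x (b i)), b i⟫_ℝ := by
  rw [killing, LinearMap.trace_eq_sum_inner _ b]
  exact Finset.sum_congr rfl fun i _ => real_inner_comm _ _

theorem killing_eq_sum_e (x : E) :
    μ.killing x = ∑ i, ⟪μ.br x (μ.br x (e i)), e i⟫_ℝ := by
  simp only [e_eq]
  exact μ.killing_eq_sum _ x

/-- Allows the norm to be computed in a basis adapted to the derived algebra. -/
theorem normSq_eq {ι : Type*} [Fintype ι] (b : OrthonormalBasis ι ℝ E) :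
    μ.normSq = ∑ i, ∑ j, ‖μ.br (b i) (b j)‖ ^ 2 := by
  have h1 : ∀ x, ∑ j, ‖μ.br x (b j)‖ ^ 2 = ∑ j, ‖μ.br x (e j)‖ ^ 2 := fun x => by
    simpa [real_inner_self_eq_norm_sq] using
      sum_bilin_orthonormalBasis b ((innerₗ E).compl₁₂ (μ.br x) (μ.br x))
  simp only [h1]
  rw [normSq, Finset.sum_comm, Finset.sum_comm (γ := ι)]
  refine Finset.sum_congr rfl fun j _ => ?_
  simpa [real_inner_self_eq_norm_sq] using
      (sum_bilin_orthonormalBasis b ((innerₗ E).compl₁₂ (μ.br.flip (e j)) (μ.br.flip (e j)))).symm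

theorem sum_killing_eq {ι : Type*} [Fintype ι] (b : OrthonormalBasis ι ℝ E) :
    ∑ i, μ.killing (e i) = ∑ i, μ.killing (b i) := by
  simpa [killing, ad] using (sum_bilin_orthonormalBasis b
    (((LinearMap.mul ℝ (Module.End ℝ E)).compl₁₂ μ.br μ.br).compr₂
      (LinearMap.trace ℝ E))).symm

/-- With structure constants `c`, the product of the two Koszul coefficients is a quarter of the
difference of squares `(c k i j - c j k i)² - (c i j k)²`. Cyclic relabelling turns each square into
`normSq` and the cross term into the trace form. -/
theorem sum_inner_nabla_nabla : ∑ i, ∑ j, ⟪μ.nabla (e i) (e j), μ.nabla (e j) (e i)⟫_ℝ =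
    1 / 4 * μ.normSq + 1 / 2 * ∑ i, μ.killing (e i) := by
  set c : Fin 7 → Fin 7 → Fin 7 → ℝ := fun i j k => ⟪μ.br (e i) (e j), e k⟫_ℝ with hc
  have hsk : ∀ i j k, c i j k = - c j i k := fun i j k => by
    simp only [hc]; rw [μ.skew, inner_neg_left]
  have hpars : ∀ x y : E, ⟪x, y⟫_ℝ = ∑ k, ⟪x, e k⟫_ℝ * ⟪y, e k⟫_ℝ := fun x y => by
    conv_lhs => rw [← sum_inner_smul_e y]
    simp [inner_sum, real_inner_smul_right, mul_comm]
  have hN : μ.normSq = ∑ i, ∑ j, ∑ k, c i j k ^ 2 := by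
    rw [normSq]
    refine Finset.sum_congr rfl fun i _ => Finset.sum_congr rfl fun j _ => ?_
    rw [← real_inner_self_eq_norm_sq, hpars]
    exact Finset.sum_congr rfl fun k _ => (sq _).symm
  have hK : ∑ i, μ.killing (e i) = ∑ i, ∑ j, ∑ k, c i j k * c i k j := by
    refine Finset.sum_congr rfl fun i _ => ?_
    rw [killing_eq_sum_e]
    refine Finset.sum_congr rfl fun j _ => ?_
    conv_lhs => rw [← sum_inner_smul_e (μ.br (e i) (e j))]
    simp only [map_sum, map_smul, sum_inner, real_inner_smul_left]
    rfl
  have hL : ∑ i, ∑ j, ⟪μ.nabla (e i) (e j), μ.nabla (e j) (e i)⟫_ℝ =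
      ∑ i, ∑ j, ∑ k, (1 / 4 * c k i j ^ 2 + 1 / 4 * c j k i ^ 2 - 1 / 4 * c i j k ^ 2
        - 1 / 2 * (c k i j * c j k i)) := by
    refine Finset.sum_congr rfl fun i _ => Finset.sum_congr rfl fun j _ => ?_
    rw [hpars]
    refine Finset.sum_congr rfl fun k _ => ?_
    rw [inner_nabla, inner_nabla]
    change 1 / 2 * (c i j k - c j k i + c k i j) * (1 / 2 * (c j i k - c i k j + c k j i)) = _
    rw [hsk j i k, hsk i k j, hsk k j i]
    ring
  have rot : ∀ f : Fin 7 → Fin 7 → Fin 7 → ℝ,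
      ∑ i, ∑ j, ∑ k, f i j k = ∑ i, ∑ j, ∑ k, f j k i := fun f => by
    conv_rhs => rw [Finset.sum_comm]
    exact Finset.sum_congr rfl fun i _ => Finset.sum_comm.trans rfl |>.symm
  have e1 : ∑ i, ∑ j, ∑ k, c k i j ^ 2 = ∑ i, ∑ j, ∑ k, c i j k ^ 2 := rot _
  have e2 : ∑ i, ∑ j, ∑ k, c j k i ^ 2 = ∑ i, ∑ j, ∑ k, c i j k ^ 2 := (rot _).symm
  have e3 : ∑ i, ∑ j, ∑ k, c k i j * c j k i = - ∑ i, ∑ j, ∑ k, c i j k * c i k j := by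
    rw [rot]
    simp only [← Finset.sum_neg_distrib]
    refine Finset.sum_congr rfl fun i _ => Finset.sum_congr rfl fun j _ =>
      Finset.sum_congr rfl fun k _ => ?_
    rw [hsk k i j]; ring
  rw [hL, hN, hK]
  simp only [Finset.sum_sub_distrib, Finset.sum_add_distrib, ← Finset.mul_sum, e1, e2, e3]
  ring

/-- The vector in the last term is the mean curvature vector `H`, with `⟪H, z⟫ = tr (ad z)`.
Skewness of `∇` reduces the curvature to products of connection terms, and the Koszul formula
handles `∇_[x,y]`. -/
theorem scal_eq : μ.scal = - (1 / 4) * μ.normSq - 1 / 2 * ∑ i, μ.killing (e i)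
    - ‖∑ i, μ.nabla (e i) (e i)‖ ^ 2 := by
  have h1 : ∀ i j, ⟪μ.riem (e i) (e j) (e j), e i⟫_ℝ =
      - ⟪μ.nabla (e j) (e j), μ.nabla (e i) (e i)⟫_ℝ
      + ⟪μ.nabla (e i) (e j), μ.nabla (e j) (e i)⟫_ℝ
      - (1 / 2 * ‖μ.br (e i) (e j)‖ ^ 2 + 1 / 2 * ⟪μ.br (e j) (μ.br (e j) (e i)), e i⟫_ℝ
        + 1 / 2 * ⟪μ.br (e i) (μ.br (e i) (e j)), e j⟫_ℝ) := fun i j => by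
    rw [riem, inner_sub_left, inner_sub_left, μ.inner_nabla_skew (e i) (μ.nabla _ _),
      μ.inner_nabla_skew (e j) (μ.nabla _ _),
      inner_nabla _ (μ.br (e i) (e j)), μ.skew _ (e j), ← real_inner_self_eq_norm_sq]
    rw [μ.skew (e j) (e i)]
    simp only [map_neg, inner_neg_left]
    ring
  have h2 : ‖∑ i, μ.nabla (e i) (e i)‖ ^ 2 =
      ∑ i, ∑ j, ⟪μ.nabla (e j) (e j), μ.nabla (e i) (e i)⟫_ℝ := by
    rw [← real_inner_self_eq_norm_sq, inner_sum]
    simp only [sum_inner]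
  have h3 : μ.scal = ∑ i, ∑ j, ⟪μ.riem (e i) (e j) (e j), e i⟫_ℝ := by
    simp only [scal, ric]
    rw [Finset.sum_comm]
  rw [h3, h2]
  simp only [h1, Finset.sum_sub_distrib, Finset.sum_add_distrib, ← Finset.mul_sum,
    sum_inner_nabla_nabla, Finset.sum_neg_distrib, ← killing_eq_sum_e]
  rw [Finset.sum_comm (f := fun i j => ⟪μ.br (e j) (μ.br (e j) (e i)), e i⟫_ℝ)]
  simp only [← killing_eq_sum_e, normSq]
  ring

end Bracket

/-! ### Real parts of eigenvalues and the numerical range. -/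

/-- A nonzero complex eigenvalue of a real operator has a real invariant plane (or line) in the
range of the operator. -/
theorem exists_real_eigenvector {A : Module.End ℝ E} {z : ℂ} (hz : z ∈ Spec A) :
    ∃ u w : E, (u ≠ 0 ∨ w ≠ 0) ∧ A u = z.re • u - z.im • w ∧ A w = z.im • u + z.re • w := by
  obtain ⟨v, hv⟩ := Module.End.HasEigenvalue.exists_hasEigenvector hz
  let re : ℂ ⊗[ℝ] E →ₗ[ℝ] E := TensorProduct.lid ℝ E ∘ₗ LinearMap.rTensor E Complex.reLm
  let im : ℂ ⊗[ℝ] E →ₗ[ℝ] E := TensorProduct.lid ℝ E ∘ₗ LinearMap.rTensor E Complex.imLm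
  have hre : ∀ v, re (A.baseChange ℂ v) = A (re v) := fun v => by
    induction v with
    | zero => simp
    | tmul a x => simp [re]
    | add x y hx hy => simp only [map_add, hx, hy]
  have him : ∀ v, im (A.baseChange ℂ v) = A (im v) := fun v => by
    induction v with
    | zero => simp
    | tmul a x => simp [im]
    | add x y hx hy => simp only [map_add, hx, hy]
  have hre' : ∀ v, re (z • v) = z.re • re v - z.im • im v := fun v => by
    induction v with
    | zero => simp
    | tmul a x => simp [re, im, TensorProduct.smul_tmul', sub_smul, mul_smul]
    | add x y hx hy => simp only [map_add, smul_add, hx, hy]; abel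
  have him' : ∀ v, im (z • v) = z.im • re v + z.re • im v := fun v => by
    induction v with
    | zero => simp
    | tmul a x => simp [re, im, TensorProduct.smul_tmul', add_smul, mul_smul, add_comm]
    | add x y hx hy => simp only [map_add, smul_add, hx, hy]; abel
  have hsum : ∀ v, (1 : ℂ) ⊗ₜ[ℝ] re v + Complex.I ⊗ₜ[ℝ] im v = v := fun v => by
    induction v with
    | zero => simp
    | tmul a x =>
      simp only [re, im, LinearMap.comp_apply, LinearMap.rTensor_tmul, LinearEquiv.coe_coe,
        TensorProduct.lid_tmul, ← TensorProduct.smul_tmul, ← TensorProduct.add_tmul]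
      congr 1
      apply Complex.ext <;> simp
    | add x y hx hy =>
      nth_rewrite 3 [← hx]
      nth_rewrite 3 [← hy]
      simp only [map_add, TensorProduct.tmul_add]; abel
  refine ⟨re v, im v, ?_, ?_, ?_⟩
  · by_contra! h
    apply hv.2
    rw [← hsum v, h.1, h.2]; simp
  · rw [← hre, hv.apply_eq_smul, hre']
  · rw [← him, hv.apply_eq_smul, him']

/-- The numerical range bound: the real parts of the eigenvalues of an operator with range in the
span of an orthonormal family are controlled by the symmetric part of its matrix. -/
theorem abs_re_le_of_mem_Spec {ι : Type*} [Fintype ι] {A : Module.End ℝ E} {n : Submodule ℝ E}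
    (b : OrthonormalBasis ι ℝ n) (hA : ∀ x, A x ∈ n) {z : ℂ} (hz : z ∈ Spec A) :
    |z.re| ≤ √(∑ i, ∑ j, (⟪A (b i), (b j : E)⟫_ℝ + ⟪A (b j), (b i : E)⟫_ℝ) ^ 2) := by
  set D := ∑ i, ∑ j, (⟪A (b i), (b j : E)⟫_ℝ + ⟪A (b j), (b i : E)⟫_ℝ) ^ 2 with hD
  obtain ⟨u, w, hne, hu, hw⟩ := exists_real_eigenvector hz
  rcases eq_or_ne z.re 0 with h0 | h0
  · rw [h0, abs_zero]; exact Real.sqrt_nonneg _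
  have hn0 : z.re ^ 2 + z.im ^ 2 ≠ 0 := by positivity
  -- Inverting the rotation-scaling by `z ≠ 0` writes `u` and `w` through `A u` and `A w`, which lie
  -- in the range.
  have hmu : u ∈ n := by
    have : (z.re ^ 2 + z.im ^ 2) • u = z.re • A u + z.im • A w := by rw [hu, hw]; module
    rw [← Submodule.smul_mem_iff n hn0, this]
    exact n.add_mem (n.smul_mem _ (hA _)) (n.smul_mem _ (hA _))
  have hmw : w ∈ n := by
    have : (z.re ^ 2 + z.im ^ 2) • w = z.re • A w - z.im • A u := by rw [hu, hw]; module
    rw [← Submodule.smul_mem_iff n hn0, this]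
    exact n.sub_mem (n.smul_mem _ (hA _)) (n.smul_mem _ (hA _))
  have key : ∀ v ∈ n, |⟪A v, v⟫_ℝ| ≤ √D * ‖v‖ ^ 2 := by
    intro v hv
    set t : ι → ℝ := fun i => ⟪b i, ⟨v, hv⟩⟫_ℝ with ht
    have hvs : v = ∑ i, t i • (b i : E) := by
      have := congrArg n.subtype (b.sum_repr' ⟨v, hv⟩)
      simpa [ht, Submodule.coe_inner] using this.symm
    have hnorm : ∑ i, t i ^ 2 = ‖v‖ ^ 2 := by
      have := b.sum_sq_norm_inner_right ⟨v, hv⟩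
      simpa [ht] using this
    have h1 : ⟪A v, v⟫_ℝ = ∑ i, ∑ j, t i * t j * ⟪A (b i), (b j : E)⟫_ℝ := by
      conv_lhs => rw [hvs]
      simp only [map_sum, map_smul, sum_inner, inner_sum, real_inner_smul_left,
        real_inner_smul_right]
      rw [Finset.sum_comm]
      exact Finset.sum_congr rfl fun i _ => Finset.sum_congr rfl fun j _ => by ring
    have h2 : 2 * ⟪A v, v⟫_ℝ =
        ∑ p : ι × ι, (⟪A (b p.1), (b p.2 : E)⟫_ℝ + ⟪A (b p.2), (b p.1 : E)⟫_ℝ) * (t p.1 * t p.2) := by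
      have h1' : ⟪A v, v⟫_ℝ = ∑ i, ∑ j, t i * t j * ⟪A (b j), (b i : E)⟫_ℝ := by
        rw [h1, Finset.sum_comm]
        exact Finset.sum_congr rfl fun i _ => Finset.sum_congr rfl fun j _ => by ring
      rw [Fintype.sum_prod_type, two_mul]
      nth_rewrite 2 [h1']
      rw [h1]
      simp only [← Finset.sum_add_distrib]
      exact Finset.sum_congr rfl fun i _ => Finset.sum_congr rfl fun j _ => by ring
    -- Cauchy–Schwarz on pairs of indices gives `(2⟪A v, v⟫)² ≤ D ‖v‖⁴`; the factor 4 is simply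
    -- dropped.
    have h3 := Finset.sum_mul_sq_le_sq_mul_sq Finset.univ
      (fun p : ι × ι => ⟪A (b p.1), (b p.2 : E)⟫_ℝ + ⟪A (b p.2), (b p.1 : E)⟫_ℝ)
      (fun p => t p.1 * t p.2)
    rw [← h2, Fintype.sum_prod_type, ← hD, Fintype.sum_prod_type] at h3
    have h4 : ∑ i, ∑ j, (t i * t j) ^ 2 = (‖v‖ ^ 2) ^ 2 := by
      rw [← hnorm, sq (∑ i, _), Finset.sum_mul_sum]
      simp only [mul_pow]
    rw [h4] at h3
    have hD0 : 0 ≤ D := by positivity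
    apply abs_le_of_sq_le_sq _ (by positivity)
    rw [mul_pow, Real.sq_sqrt hD0]
    nlinarith [sq_nonneg ⟪A v, v⟫_ℝ]
  have hre : z.re * (‖u‖ ^ 2 + ‖w‖ ^ 2) = ⟪A u, u⟫_ℝ + ⟪A w, w⟫_ℝ := by
    rw [hu, hw, inner_sub_left, inner_add_left]
    simp only [real_inner_smul_left, real_inner_self_eq_norm_sq, real_inner_comm u w]
    ring
  have hpos : 0 < ‖u‖ ^ 2 + ‖w‖ ^ 2 := by
    rcases hne with h | h
    · have := norm_pos_iff.2 h
      positivity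
    · have := norm_pos_iff.2 h
      positivity
  refine le_of_mul_le_mul_right ?_ hpos
  calc |z.re| * (‖u‖ ^ 2 + ‖w‖ ^ 2) = |⟪A u, u⟫_ℝ + ⟪A w, w⟫_ℝ| := by
        rw [← hre, abs_mul, abs_of_pos hpos]
    _ ≤ |⟪A u, u⟫_ℝ| + |⟪A w, w⟫_ℝ| := abs_add_le _ _
    _ ≤ √D * ‖u‖ ^ 2 + √D * ‖w‖ ^ 2 := add_le_add (key u hmu) (key w hmw)
    _ = _ := by ring

/-- Orthonormal bases of a subspace and of its orthogonal complement fit together. -/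
theorem exists_adapted_orthonormalBasis {ι κ : Type*} [Fintype ι] [Fintype κ]
    {n : Submodule ℝ E} (X : OrthonormalBasis ι ℝ n) (A : OrthonormalBasis κ ℝ nᗮ) :
    ∃ b : OrthonormalBasis (ι ⊕ κ) ℝ E,
      (∀ i, b (Sum.inl i) = X i) ∧ ∀ j, b (Sum.inr j) = A j := by
  refine ⟨(X.prod A).map n.orthogonalDecomposition.symm, fun i => ?_, fun i => ?_⟩
  · rw [OrthonormalBasis.map_apply, OrthonormalBasis.prod_apply]
    change (X i : E) + ((0 : nᗮ) : E) = X i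
    simp
  · rw [OrthonormalBasis.map_apply, OrthonormalBasis.prod_apply]
    change ((0 : n) : E) + (A i : E) = A i
    simp

/-- The squared norm of the symmetrised matrix of an operator with range in `n`. -/
theorem sum_symm_sq_eq {ι κ : Type*} [Fintype ι] [Fintype κ] {n : Submodule ℝ E}
    (X : OrthonormalBasis ι ℝ n) (A : OrthonormalBasis κ ℝ nᗮ) {T : Module.End ℝ E}
    (hT : ∀ x, T x ∈ n) :
    ∑ i, ∑ j, (⟪T (X i), (X j : E)⟫_ℝ + ⟪T (X j), (X i : E)⟫_ℝ) ^ 2 =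
      2 * ∑ i, ‖T (X i)‖ ^ 2 + 2 * LinearMap.trace ℝ E (T * T) := by
  obtain ⟨b, hbl, hbr⟩ := exists_adapted_orthonormalBasis X A
  have hM : ∑ i, ‖T (X i)‖ ^ 2 = ∑ i, ∑ j, ⟪T (X i), (X j : E)⟫_ℝ ^ 2 := by
    refine Finset.sum_congr rfl fun i _ => ?_
    have := X.sum_sq_norm_inner_left ⟨T (X i), hT _⟩
    simpa using this.symm
  have hperp : ∀ x i, ⟪(A i : E), T x⟫_ℝ = 0 := fun x i =>
    (Submodule.mem_orthogonal' _ _).1 (A i).2 _ (hT x)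
  -- The diagonal entries along `nᗮ` vanish because the range of `T` lies in `n`.
  have hk : LinearMap.trace ℝ E (T * T) =
      ∑ i, ∑ j, ⟪T (X i), (X j : E)⟫_ℝ * ⟪T (X j), (X i : E)⟫_ℝ := by
    rw [LinearMap.trace_eq_sum_inner _ b, Fintype.sum_sum_type]
    simp only [hbl, hbr, Module.End.mul_apply, hperp, Finset.sum_const_zero, add_zero]
    refine Finset.sum_congr rfl fun i _ => ?_
    have h1 : T (X i) = ∑ j, ⟪T (X i), (X j : E)⟫_ℝ • (X j : E) := by
      have := congrArg n.subtype (X.sum_repr' ⟨T (X i), hT _⟩)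
      simp only [fun j => real_inner_comm (X j : E) (T (X i))]
      simpa [Submodule.coe_inner] using this.symm
    conv_lhs => rw [real_inner_comm, h1]
    simp only [map_sum, map_smul, sum_inner, real_inner_smul_left]
  have hflip : ∑ i, ∑ j, ⟪T (X j), (X i : E)⟫_ℝ ^ 2 =
      ∑ i, ∑ j, ⟪T (X i), (X j : E)⟫_ℝ ^ 2 := Finset.sum_comm
  rw [hM, hk]
  simp only [add_sq, Finset.sum_add_distrib, mul_assoc, ← Finset.mul_sum, hflip]
  ring

/-! ### Scalar curvature controls the norm of the bracket. -/

namespace Bracket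

/-- The real eigenvalue parts control the negative part of the trace form, with constant `C`. -/
def TraceBound (μ : Bracket) (C : ℝ) : Prop :=
  ∀ x, ∀ r : ℝ, (∀ z ∈ Spec (μ.ad x), |z.re| ≤ r) → 0 ≤ r → - μ.killing x ≤ C * r ^ 2

theorem ad_act (μ : Bracket) (h : E ≃ₗ[ℝ] E) (x : E) :
    (μ.act h).ad x = h.conj (μ.ad (h.symm x)) := rfl

/-- Conjugation preserves both traces and spectra, so one constant serves the whole orbit; this is
the source of uniformity. -/
theorem TraceBound.act {μ : Bracket} {C : ℝ} (hC : μ.TraceBound C) (h : E ≃ₗ[ℝ] E) :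
    (μ.act h).TraceBound C := by
  intro x r hr hr0
  have h1 : (μ.act h).killing x = μ.killing (h.symm x) := by
    have : h.conj (μ.ad (h.symm x)) * h.conj (μ.ad (h.symm x)) =
        h.conj (μ.ad (h.symm x) * μ.ad (h.symm x)) := (h.conj_comp _ _).symm
    rw [killing, killing, ad_act, this, LinearMap.trace_conj']
  rw [h1]
  refine hC _ r (fun z hz => hr z ?_) hr0
  rw [ad_act]
  obtain ⟨v, hv⟩ := Module.End.HasEigenvalue.exists_hasEigenvector hz
  have hcomp : ∀ v, (LinearMap.baseChange ℂ (h.conj (μ.ad (h.symm x))))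
      (h.toLinearMap.baseChange ℂ v) =
      h.toLinearMap.baseChange ℂ ((μ.ad (h.symm x)).baseChange ℂ v) := fun v => by
    simp only [← LinearMap.comp_apply, ← LinearMap.baseChange_comp]
    congr 2
    ext y : 1
    simp [LinearEquiv.conj_apply]
  have hinj : ∀ v, h.symm.toLinearMap.baseChange ℂ (h.toLinearMap.baseChange ℂ v) = v :=
    fun v => by
      rw [← LinearMap.comp_apply, ← LinearMap.baseChange_comp]
      simp
  refine Module.End.hasEigenvalue_of_hasEigenvector (x := h.toLinearMap.baseChange ℂ v)
    ⟨Module.End.mem_eigenspace_iff.2 ?_, fun h0 => hv.2 ?_⟩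
  · rw [hcomp, hv.apply_eq_smul, map_smul]
  · rw [← hinj v, h0, map_zero]

/-- The scalar curvature of a solvable bracket controls its norm. -/
theorem normSq_le_scal {μ : Bracket} (hμ : μ ∈ solvable) {C : ℝ} (hC0 : 0 ≤ C)
    (hC : μ.TraceBound C) : μ.normSq ≤ (4 + 8 * C) * - μ.scal := by
  let n : Submodule ℝ E := Submodule.span ℝ {w | ∃ y z, w = μ.br y z}
  have hmem : ∀ x y, μ.br x y ∈ n := fun x y => Submodule.subset_span ⟨x, y, rfl⟩
  obtain ⟨X⟩ : Nonempty (OrthonormalBasis (Fin (Module.finrank ℝ n)) ℝ n) :=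
    ⟨stdOrthonormalBasis ℝ n⟩
  obtain ⟨A⟩ : Nonempty (OrthonormalBasis (Fin (Module.finrank ℝ nᗮ)) ℝ nᗮ) :=
    ⟨stdOrthonormalBasis ℝ nᗮ⟩
  obtain ⟨b, hbl, hbr⟩ := exists_adapted_orthonormalBasis X A
  have hN := μ.normSq_eq b
  have hK := μ.sum_killing_eq b
  have hS := μ.scal_eq
  simp only [Fintype.sum_sum_type, hbl, hbr, Finset.sum_add_distrib] at hN hK
  have hK0 : ∑ i, μ.killing (X i) = 0 := Finset.sum_eq_zero fun i _ =>
    trace_ad_sq_eq_zero hμ (X i).2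
  obtain ⟨M, hM⟩ : ∃ M : E → ℝ, ∀ a, M a = ∑ i, ‖μ.br a (X i)‖ ^ 2 := ⟨_, fun _ => rfl⟩
  obtain ⟨D, hD⟩ : ∃ D : E → ℝ, ∀ a, D a = ∑ i, ∑ j, (⟪μ.ad a (X i), (X j : E)⟫_ℝ
    + ⟪μ.ad a (X j), (X i : E)⟫_ℝ) ^ 2 := ⟨_, fun _ => rfl⟩
  have hDeq : ∀ a, D a = 2 * M a + 2 * μ.killing a := fun a => by
    rw [hD, hM]
    -- `D a` is the squared norm of the symmetrised matrix of `ad a` on the derived algebra `n`.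
    exact sum_symm_sq_eq X A (T := μ.ad a) (hmem a)
  have hD0 : ∀ a, 0 ≤ D a := fun a => by rw [hD]; positivity
  have hkD : ∀ a, - μ.killing a ≤ C * D a := fun a => by
    have := hC a (√(D a)) (fun z hz => by
      rw [hD]
      exact abs_re_le_of_mem_Spec X (hmem a) hz) (Real.sqrt_nonneg _)
    rwa [Real.sq_sqrt (hD0 a)] at this
  have hXA : ∑ i, ∑ j, ‖μ.br (X i) (A j)‖ ^ 2 = ∑ j, M (A j) := by
    rw [Finset.sum_comm]
    refine Finset.sum_congr rfl fun j _ => ?_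
    rw [hM]
    refine Finset.sum_congr rfl fun i _ => ?_
    rw [μ.skew, norm_neg]
  simp only [hXA, ← hM] at hN
  rw [hK0, zero_add] at hK
  have hDs : ∑ j, D (A j) = 2 * ∑ j, M (A j) + 2 * ∑ j, μ.killing (A j) := by
    simp only [hDeq, Finset.sum_add_distrib, Finset.mul_sum]
  have hks : - ∑ j, μ.killing (A j) ≤ C * ∑ j, D (A j) := by
    rw [← Finset.sum_neg_distrib, Finset.mul_sum]
    exact Finset.sum_le_sum fun j _ => hkD _
  have hXX : 0 ≤ ∑ i, M (X i) := Finset.sum_nonneg fun i _ => by rw [hM]; positivity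
  have hAA : 0 ≤ ∑ i, ∑ j, ‖μ.br (A i) (A j)‖ ^ 2 := by positivity
  have hH := sq_nonneg ‖∑ i, μ.nabla (e i) (e i)‖
  have hDD : 0 ≤ ∑ j, D (A j) := Finset.sum_nonneg fun j _ => hD0 _
  -- The mixed block and the trace form enter `-scal` as half the sum of `M + killing` over the `A
  -- j`, which is a quarter of the sum of `D`; the mean curvature term only helps.
  have h1 : (∑ i, M (X i) + ∑ i, ∑ j, ‖μ.br (A i) (A j)‖ ^ 2
      + ∑ j, D (A j)) / 4 ≤ - μ.scal := by rw [hS, hK, hN]; linarith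
  have h2 := mul_nonneg hC0 hXX
  have h3 := mul_nonneg hC0 hAA
  have h4 := mul_le_mul_of_nonneg_left h1 (by linarith : 0 ≤ 4 + 8 * C)
  rw [hN]
  -- In `normSq` the mixed block counts twice, and `2 M = D - 2 killing` sums to at most `(1 + 2C) ∑
  -- D`. With the quarter in `h1` this gives `4 (1 + 2C)`.
  refine le_trans ?_ h4
  linarith

end Bracket

/-! ### Crude curvature bounds and the pinching estimate. -/

namespace Bracket

variable (μ : Bracket)

theorem normSq_nonneg : 0 ≤ μ.normSq := by unfold normSq; positivity

theorem norm_br_e_le (i j : Fin 7) : ‖μ.br (e i) (e j)‖ ≤ √μ.normSq := by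
  apply Real.le_sqrt_of_sq_le
  refine le_trans ?_ (Finset.single_le_sum (f := fun i => ∑ j, ‖μ.br (e i) (e j)‖ ^ 2)
    (fun i _ => by positivity) (Finset.mem_univ i))
  exact Finset.single_le_sum (f := fun j => ‖μ.br (e i) (e j)‖ ^ 2)
    (fun j _ => by positivity) (Finset.mem_univ j)

theorem norm_br_le (x y : E) : ‖μ.br x y‖ ≤ 49 * √μ.normSq * ‖x‖ * ‖y‖ := by
  have hc : ∀ (x : E) k, |⟪x, e k⟫_ℝ| ≤ ‖x‖ := fun x k => by
    simpa [norm_e] using abs_real_inner_le_norm x (e k)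
  have h : μ.br x y = ∑ i, ∑ j, (⟪x, e i⟫_ℝ * ⟪y, e j⟫_ℝ) • μ.br (e i) (e j) := by
    conv_lhs => rw [← sum_inner_smul_e x, ← sum_inner_smul_e y]
    simp only [map_sum, map_smul, LinearMap.sum_apply, LinearMap.smul_apply, Finset.smul_sum,
      smul_smul]
    rw [Finset.sum_comm]
    simp only [mul_comm]
  calc ‖μ.br x y‖ ≤ ∑ i : Fin 7, ∑ j : Fin 7, ‖x‖ * ‖y‖ * √μ.normSq := by
        rw [h]
        refine norm_sum_le_of_le _ fun i _ => norm_sum_le_of_le _ fun j _ => ?_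
        rw [norm_smul, norm_mul]
        exact mul_le_mul (mul_le_mul (hc x i) (hc y j) (abs_nonneg _) (norm_nonneg _))
          (μ.norm_br_e_le i j) (norm_nonneg _) (by positivity)
    _ = _ := by simp; ring

/-- Pairing `∇_x y` with itself in the Koszul formula gives three terms, hence `3 · 49 / 2 = 73.5`,
rounded up. -/
theorem norm_nabla_le (x y : E) : ‖μ.nabla x y‖ ≤ 75 * √μ.normSq * ‖x‖ * ‖y‖ := by
  have hb : ∀ a b c : E, |⟪μ.br a b, c⟫_ℝ| ≤ 49 * √μ.normSq * ‖a‖ * ‖b‖ * ‖c‖ := fun a b c =>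
    (abs_real_inner_le_norm _ _).trans
      (mul_le_mul_of_nonneg_right (μ.norm_br_le a b) (norm_nonneg c))
  set z := μ.nabla x y with hz
  have h := μ.inner_nabla x y z
  rw [← hz, real_inner_self_eq_norm_sq] at h
  have h1 := abs_le.1 (hb x y z)
  have h2 := abs_le.1 (hb y z x)
  have h3 := abs_le.1 (hb z x y)
  rcases eq_or_ne ‖z‖ 0 with h0 | h0
  · rw [h0]; positivity
  · have hpos : 0 < ‖z‖ := lt_of_le_of_ne (norm_nonneg _) (Ne.symm h0)
    refine le_of_mul_le_mul_right ?_ hpos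
    have h4 : 0 ≤ √μ.normSq * ‖x‖ * ‖y‖ * ‖z‖ := by positivity
    nlinarith

/-- Curvature is quadratic in the bracket; `2 · 75² + 75 · 49 = 14925` is rounded up, as only
homogeneity matters. -/
theorem norm_riem_le (x y z : E) :
    ‖μ.riem x y z‖ ≤ 20000 * μ.normSq * ‖x‖ * ‖y‖ * ‖z‖ := by
  have hs : √μ.normSq * √μ.normSq = μ.normSq := Real.mul_self_sqrt μ.normSq_nonneg
  have h2 : ∀ x y z, ‖μ.nabla x (μ.nabla y z)‖ ≤ 5625 * μ.normSq * ‖x‖ * ‖y‖ * ‖z‖ :=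
    fun x y z => by
      refine (μ.norm_nabla_le _ _).trans ((mul_le_mul_of_nonneg_left (μ.norm_nabla_le y z)
        (by positivity)).trans (le_of_eq ?_))
      linear_combination (5625 * ‖x‖ * ‖y‖ * ‖z‖) * hs
  have h3 : ‖μ.nabla (μ.br x y) z‖ ≤ 3675 * μ.normSq * ‖x‖ * ‖y‖ * ‖z‖ := by
    refine (μ.norm_nabla_le _ _).trans ((mul_le_mul_of_nonneg_right (mul_le_mul_of_nonneg_left
      (μ.norm_br_le x y) (by positivity)) (norm_nonneg _)).trans (le_of_eq ?_))
    linear_combination (3675 * ‖x‖ * ‖y‖ * ‖z‖) * hs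
  have h4 : 0 ≤ μ.normSq * ‖x‖ * ‖y‖ * ‖z‖ := by
    have := μ.normSq_nonneg
    positivity
  have h5 := h2 y x z
  unfold riem
  refine (norm_sub_le _ _).trans ((add_le_add_left (norm_sub_le _ _) _).trans ?_)
  nlinarith [h2 x y z]

theorem ricNormSq_le : μ.ricNormSq ≤ 49 * (140000 * μ.normSq) ^ 2 := by
  have h : ∀ i j, μ.ric (e i) (e j) ^ 2 ≤ (140000 * μ.normSq) ^ 2 := fun i j => by
    rw [← sq_abs]
    refine pow_le_pow_left₀ (abs_nonneg _) ?_ 2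
    calc |μ.ric (e i) (e j)| ≤ ∑ k : Fin 7, 20000 * μ.normSq := by
          refine (Finset.abs_sum_le_sum_abs _ _).trans (Finset.sum_le_sum fun k _ => ?_)
          refine (abs_real_inner_le_norm _ _).trans ?_
          simpa [norm_e] using μ.norm_riem_le (e k) (e i) (e j)
      _ = _ := by simp; ring
  calc μ.ricNormSq ≤ ∑ i : Fin 7, ∑ j : Fin 7, (140000 * μ.normSq) ^ 2 :=
        Finset.sum_le_sum fun i _ => Finset.sum_le_sum fun j _ => h i j
    _ = _ := by simp; ring

/-- Ensures that nonzero scalar curvature makes the denominator of `F` positive. -/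
theorem scal_sq_le : μ.scal ^ 2 ≤ 7 * μ.ricNormSq := by
  have h := sq_sum_le_card_mul_sum_sq (s := Finset.univ) (f := fun i => μ.ric (e i) (e i))
  refine h.trans ?_
  simp only [Finset.card_univ, Fintype.card_fin]
  refine mul_le_mul_of_nonneg_left (Finset.sum_le_sum fun i _ => ?_) (by norm_num)
  exact Finset.single_le_sum (f := fun j => μ.ric (e i) (e j) ^ 2)
    (fun j _ => sq_nonneg _) (Finset.mem_univ i)

theorem br_eq_zero_of_normSq_nonpos (h : μ.normSq ≤ 0) (x y : E) : μ.br x y = 0 := by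
  have h0 := le_antisymm h μ.normSq_nonneg
  have := μ.norm_br_le x y
  rw [h0, Real.sqrt_zero] at this
  exact norm_le_zero_iff.1 (by simpa using this)

theorem isLieAbelian_iff : IsLieAbelian μ.Alg ↔ ∀ x y, μ.br x y = 0 :=
  ⟨fun h x y => h.trivial x y, fun h => ⟨fun x y => h x y⟩⟩

variable {μ}

/-- A lower bound for the pinching functional. -/
theorem le_F {K : ℝ} (hN : 0 < μ.normSq) (hK : 0 < K) (h : μ.normSq ≤ K * - μ.scal) :
    1 / (49 * 140000 ^ 2 * K ^ 2) ≤ μ.F := by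
  have hs : 0 < - μ.scal := (mul_pos_iff_of_pos_left hK).1 (hN.trans_le h)
  have h1 : 0 < μ.ricNormSq := by nlinarith [μ.scal_sq_le, sq_nonneg μ.scal, mul_pos hs hs]
  have h2 : μ.normSq ^ 2 ≤ (K * - μ.scal) ^ 2 := pow_le_pow_left₀ hN.le h 2
  rw [F, div_le_div_iff₀ (by positivity) h1]
  nlinarith [μ.ricNormSq_le]

end Bracket

/-! ### Coordinates of `φ`, `*φ` and the exterior derivative. -/

/-- The sign in `e_a × e_b = ± e_c`. -/
def crossSign : Fin 7 → Fin 7 → ℝ :=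
  ![![0, 1, 1, -1, -1, 1, -1], ![-1, 0, -1, -1, 1, 1, 1], ![-1, 1, 0, 1, 1, -1, -1],
    ![1, 1, -1, 0, -1, -1, 1], ![1, -1, -1, 1, 0, 1, -1], ![-1, -1, 1, 1, -1, 0, 1],
    ![1, -1, 1, -1, 1, -1, 0]]

/-- The index in `e_a × e_b = ± e_c`. -/
def crossIdx : Fin 7 → Fin 7 → Fin 7 :=
  -- The diagonal zeros are placeholders, harmless because `crossSign` vanishes there.
  ![![0, 6, 4, 5, 2, 3, 1], ![6, 0, 5, 4, 3, 2, 0], ![4, 5, 0, 6, 0, 1, 3],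
    ![5, 4, 6, 0, 1, 0, 2], ![2, 3, 0, 1, 0, 6, 5], ![3, 2, 1, 0, 6, 0, 4],
    ![1, 0, 3, 2, 5, 4, 0]]

theorem eForm_apply {k : ℕ} (i : Fin k → Fin 7) (v : Fin k → E) :
    eForm i v = Matrix.det (Matrix.of fun a b => v a (i b)) := rfl

theorem phi_apply_e (x : E) (a b : Fin 7) :
    phi ![x, e a, e b] = crossSign a b * x (crossIdx a b) := by
  simp only [phi, AlternatingMap.sub_apply, AlternatingMap.add_apply, eForm_apply,
    Matrix.det_fin_three, Matrix.of_apply, e]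
  fin_cases a <;> fin_cases b <;> simp [crossSign, crossIdx]

/-- For given `j, k` only `i = crossIdx j k` gives a nonzero coefficient, so one of the three sums
collapses. -/
theorem sum_phi_smul_apply (W : Fin 7 → Fin 7 → Fin 7 → E [⋀^Fin 4]→ₗ[ℝ] ℝ) (v : Fin 4 → E) :
    (∑ i, ∑ j, ∑ k, if i < j ∧ j < k then phi ![e i, e j, e k] • W i j k else 0) v =
    ∑ j, ∑ k, if crossIdx j k < j ∧ j < k then crossSign j k * W (crossIdx j k) j k v else 0 := by
  have hs : ∀ f : Fin 7 → E [⋀^Fin 4]→ₗ[ℝ] ℝ, (∑ i, f i) v = ∑ i, f i v := fun f =>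
    map_sum (AddMonoidHom.mk' (fun f : E [⋀^Fin 4]→ₗ[ℝ] ℝ => f v)
      fun f g => AlternatingMap.add_apply f g v) f Finset.univ
  simp only [hs]
  rw [Finset.sum_comm]
  refine Finset.sum_congr rfl fun j _ => ?_
  rw [Finset.sum_comm]
  refine Finset.sum_congr rfl fun k _ => ?_
  rw [Finset.sum_eq_single (crossIdx j k)]
  · split_ifs
    · rw [AlternatingMap.smul_apply, phi_apply_e]
      simp [e]
    · exact AlternatingMap.zero_apply v
  · intro i _ hi
    split_ifs
    · rw [AlternatingMap.smul_apply, phi_apply_e]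
      simp [e, Ne.symm hi]
    · exact AlternatingMap.zero_apply v
  · simp

theorem sum_crossSign (V : Fin 7 → Fin 7 → Fin 7 → ℝ) :
    (∑ j, ∑ k, if crossIdx j k < j ∧ j < k then crossSign j k * V (crossIdx j k) j k else 0) =
      V 0 1 6 + V 2 3 6 + V 4 5 6 + V 0 2 4 - V 0 3 5 - V 1 2 5 - V 1 3 4 := by
  simp [Fin.sum_univ_seven, crossSign, crossIdx]
  ring

theorem curryLeft_curryLeft_curryLeft_apply (ω : E [⋀^Fin 7]→ₗ[ℝ] ℝ) (x y z : E) (v : Fin 4 → E) :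
    (((ω.curryLeft x).curryLeft y).curryLeft z) v =
      ω (Matrix.vecCons x (Matrix.vecCons y (Matrix.vecCons z v))) := rfl

theorem star3_phi_apply (v : Fin 4 → E) : star3 phi v =
    vol (Matrix.vecCons (e 0) (Matrix.vecCons (e 1) (Matrix.vecCons (e 6) v)))
    + vol (Matrix.vecCons (e 2) (Matrix.vecCons (e 3) (Matrix.vecCons (e 6) v)))
    + vol (Matrix.vecCons (e 4) (Matrix.vecCons (e 5) (Matrix.vecCons (e 6) v)))
    + vol (Matrix.vecCons (e 0) (Matrix.vecCons (e 2) (Matrix.vecCons (e 4) v)))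
    - vol (Matrix.vecCons (e 0) (Matrix.vecCons (e 3) (Matrix.vecCons (e 5) v)))
    - vol (Matrix.vecCons (e 1) (Matrix.vecCons (e 2) (Matrix.vecCons (e 5) v)))
    - vol (Matrix.vecCons (e 1) (Matrix.vecCons (e 3) (Matrix.vecCons (e 4) v))) := by
  rw [star3, sum_phi_smul_apply, sum_crossSign fun i j k =>
    (((vol.curryLeft (e i)).curryLeft (e j)).curryLeft (e k)) v]
  rw [curryLeft_curryLeft_curryLeft_apply, curryLeft_curryLeft_curryLeft_apply,
    curryLeft_curryLeft_curryLeft_apply, curryLeft_curryLeft_curryLeft_apply,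
    curryLeft_curryLeft_curryLeft_apply, curryLeft_curryLeft_curryLeft_apply,
    curryLeft_curryLeft_curryLeft_apply]

/-- Laplace expansion along the first row, whose only nonzero entry is in column `b`. -/
theorem eForm_vecCons_e {k : ℕ} {i : Fin (k + 1) → Fin 7} (hi : Function.Injective i)
    (b : Fin (k + 1)) {m : Fin 7} (hm : m = i b) (v : Fin k → E) :
    eForm i (Matrix.vecCons (e m) v) = (-1) ^ (b : ℕ) * eForm (i ∘ b.succAbove) v := by
  rw [eForm_apply, Matrix.det_succ_row_zero, Finset.sum_eq_single b]
  · simp [eForm_apply, e, hm]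
    rfl
  · intro c _ hc
    have : i c ≠ i b := fun h => hc (hi h)
    simp [e, hm, this]
  · simp

/-- `*φ = e^{3456} + e^{1256} + e^{1234} + ⋯`. -/
theorem star3_phi : star3 phi = eForm ![2, 3, 4, 5] + eForm ![0, 1, 4, 5] + eForm ![0, 1, 2, 3]
    - eForm ![1, 3, 5, 6] + eForm ![1, 2, 4, 6] + eForm ![0, 3, 4, 6] + eForm ![0, 2, 5, 6] := by
  -- `b` and `c` are the positions of `j` and `k` among the indices left after the earlier
  -- deletions; they determine the sign.
  have key : ∀ (i j k : Fin 7) (b : Fin 6) (c : Fin 5) (hj : j = i.succAbove b)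
      (hk : k = (i.succAbove ∘ b.succAbove) c) (v : Fin 4 → E),
      vol (Matrix.vecCons (e i) (Matrix.vecCons (e j) (Matrix.vecCons (e k) v))) =
      (-1) ^ (i + b + c : ℕ) * eForm (i.succAbove ∘ b.succAbove ∘ c.succAbove) v := by
    intro i j k b c hj hk v
    rw [vol, eForm_vecCons_e (i := id) Function.injective_id i (m := i) rfl, Function.id_comp,
      eForm_vecCons_e Fin.succAbove_right_injective b hj,
      eForm_vecCons_e (Fin.succAbove_right_injective.comp Fin.succAbove_right_injective) c hk,
      pow_add, pow_add]
    simp only [mul_assoc]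
    rfl
  ext v
  rw [star3_phi_apply, key 0 1 6 0 4 (by decide) (by decide), key 2 3 6 2 4 (by decide) (by decide),
    key 4 5 6 4 4 (by decide) (by decide), key 0 2 4 1 2 (by decide) (by decide),
    key 0 3 5 2 3 (by decide) (by decide), key 1 2 5 1 3 (by decide) (by decide),
    key 1 3 4 2 2 (by decide) (by decide)]
  have h1 : (0 : Fin 7).succAbove ∘ (0 : Fin 6).succAbove ∘ (4 : Fin 5).succAbove = ![2, 3, 4, 5] := by
    decide
  have h2 : (2 : Fin 7).succAbove ∘ (2 : Fin 6).succAbove ∘ (4 : Fin 5).succAbove = ![0, 1, 4, 5] := by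
    decide
  have h3 : (4 : Fin 7).succAbove ∘ (4 : Fin 6).succAbove ∘ (4 : Fin 5).succAbove = ![0, 1, 2, 3] := by
    decide
  have h4 : (0 : Fin 7).succAbove ∘ (1 : Fin 6).succAbove ∘ (2 : Fin 5).succAbove = ![1, 3, 5, 6] := by
    decide
  have h5 : (0 : Fin 7).succAbove ∘ (2 : Fin 6).succAbove ∘ (3 : Fin 5).succAbove = ![1, 2, 4, 6] := by
    decide
  have h6 : (1 : Fin 7).succAbove ∘ (1 : Fin 6).succAbove ∘ (3 : Fin 5).succAbove = ![0, 3, 4, 6] := by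
    decide
  have h7 : (1 : Fin 7).succAbove ∘ (2 : Fin 6).succAbove ∘ (2 : Fin 5).succAbove = ![0, 2, 5, 6] := by
    decide
  rw [h1, h2, h3, h4, h5, h6, h7]
  simp only [AlternatingMap.sub_apply, AlternatingMap.add_apply]
  norm_num
  ring

theorem phi_apply (x y z : E) : phi ![x, y, z] =
    ∑ p, x p * ∑ q, y q * crossSign p q * z (crossIdx p q) := by
  simp only [phi, AlternatingMap.sub_apply, AlternatingMap.add_apply, eForm_apply,
    Matrix.det_fin_three, Matrix.of_apply, Fin.sum_univ_seven]
  simp [crossSign, crossIdx]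
  ring

theorem det_fin_four (A : Matrix (Fin 4) (Fin 4) ℝ) : A.det =
    A 0 0 * (A 1 1 * (A 2 2 * A 3 3 - A 2 3 * A 3 2) - A 1 2 * (A 2 1 * A 3 3 - A 2 3 * A 3 1)
      + A 1 3 * (A 2 1 * A 3 2 - A 2 2 * A 3 1))
    - A 0 1 * (A 1 0 * (A 2 2 * A 3 3 - A 2 3 * A 3 2) - A 1 2 * (A 2 0 * A 3 3 - A 2 3 * A 3 0)
      + A 1 3 * (A 2 0 * A 3 2 - A 2 2 * A 3 0))
    + A 0 2 * (A 1 0 * (A 2 1 * A 3 3 - A 2 3 * A 3 1) - A 1 1 * (A 2 0 * A 3 3 - A 2 3 * A 3 0)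
      + A 1 3 * (A 2 0 * A 3 1 - A 2 1 * A 3 0))
    - A 0 3 * (A 1 0 * (A 2 1 * A 3 2 - A 2 2 * A 3 1) - A 1 1 * (A 2 0 * A 3 2 - A 2 2 * A 3 0)
      + A 1 2 * (A 2 0 * A 3 1 - A 2 1 * A 3 0)) := by
  rw [Matrix.det_succ_row_zero]
  simp [Fin.sum_univ_four, Matrix.det_fin_three, Fin.succAbove]
  ring

/-- The contraction identity between `φ` and `*φ`. -/
theorem star3_phi_eq_sum (w x y z : E) : star3 phi ![w, x, y, z] =
    - ∑ p, phi ![w, e p, x] * phi ![e p, y, z] - ⟪w, y⟫_ℝ * ⟪x, z⟫_ℝ + ⟪w, z⟫_ℝ * ⟪x, y⟫_ℝ := by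
  have h1 : ∀ p y z, phi ![e p, y, z] = ∑ q, y q * crossSign p q * z (crossIdx p q) :=
    fun p y z => by
      rw [phi_apply, Finset.sum_eq_single p]
      · simp [e]
      · intro q _ hq
        simp [e, hq]
      · simp
  have h2 : ∀ p, phi ![w, e p, x] = - phi ![e p, w, x] := fun p => by
    have := phi.map_swap ![w, e p, x] (show (0 : Fin 3) ≠ 1 by decide)
    rw [← neg_eq_iff_eq_neg, ← this]
    congr 1
    ext k : 1
    fin_cases k <;> rfl
  rw [star3_phi]
  simp only [h2, h1, AlternatingMap.sub_apply, AlternatingMap.add_apply, eForm_apply,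
    det_fin_four, Matrix.of_apply, PiLp.inner_apply, Fin.sum_univ_seven]
  simp [crossSign, crossIdx]
  ring

/-- In the contraction identity the conditions on `a` remove the metric terms, and only `p =
crossIdx b c` survives. -/
theorem star3_phi_apply_e (w : E) {a b c : Fin 7} (hab : a ≠ b) (hac : a ≠ c) :
    star3 phi ![w, e a, e b, e c] =
      - (crossSign b c * crossSign (crossIdx b c) a * w (crossIdx (crossIdx b c) a)) := by
  rw [star3_phi_eq_sum, inner_e_e, inner_e_e, if_neg hac, if_neg hab,
    Finset.sum_eq_single (crossIdx b c)]
  · rw [phi_apply_e, phi_apply_e]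
    simp [e]
    ring
  · intro p _ hp
    rw [phi_apply_e (e p)]
    simp [e, Ne.symm hp]
  · simp

namespace Bracket

theorem d_three (μ : Bracket) (ω : E [⋀^Fin 3]→ₗ[ℝ] ℝ) (w x y z : E) : μ.d ω ![w, x, y, z] =
   - ω ![μ.br w x, y, z] + ω ![μ.br w y, x, z] - ω ![μ.br w z, x, y] - ω ![μ.br x y, w, z]
   + ω ![μ.br x z, w, y] - ω ![μ.br y z, w, x] := by
  have h : ∀ (i : Fin 3) (j : Fin 4) (p q : Fin 4) (v : Fin 4 → E),
      j.succAbove (i.succAbove 0) = p → j.succAbove (i.succAbove 1) = q →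
      i.removeNth (j.removeNth v) = ![v p, v q] := by
    rintro i j p q v rfl rfl
    ext k : 1
    fin_cases k <;> rfl
  rw [d, Fin.sum_univ_four]
  rw [Fin.sum_univ_three, Fin.sum_univ_three, Fin.sum_univ_three, Fin.sum_univ_three]
  rw [h 0 1 2 3 _ rfl rfl, h 0 2 1 3 _ rfl rfl, h 0 3 1 2 _ rfl rfl, h 1 2 0 3 _ rfl rfl,
    h 1 3 0 2 _ rfl rfl, h 2 3 0 1 _ rfl rfl]
  simp
  ring

theorem d_four (μ : Bracket) (ω : E [⋀^Fin 4]→ₗ[ℝ] ℝ) (u w x y z : E) : μ.d ω ![u, w, x, y, z] =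
   - ω ![μ.br u w, x, y, z] + ω ![μ.br u x, w, y, z] - ω ![μ.br u y, w, x, z]
   + ω ![μ.br u z, w, x, y] - ω ![μ.br w x, u, y, z] + ω ![μ.br w y, u, x, z]
   - ω ![μ.br w z, u, x, y] - ω ![μ.br x y, u, w, z] + ω ![μ.br x z, u, w, y]
   - ω ![μ.br y z, u, w, x] := by
  have h : ∀ (i : Fin 4) (j : Fin 5) (p q r : Fin 5) (v : Fin 5 → E),
      j.succAbove (i.succAbove 0) = p → j.succAbove (i.succAbove 1) = q →
      j.succAbove (i.succAbove 2) = r →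
      i.removeNth (j.removeNth v) = ![v p, v q, v r] := by
    rintro i j p q r v rfl rfl rfl
    ext k : 1
    fin_cases k <;> rfl
  rw [d, Fin.sum_univ_five]
  rw [Fin.sum_univ_four, Fin.sum_univ_four, Fin.sum_univ_four, Fin.sum_univ_four,
    Fin.sum_univ_four]
  rw [h 0 1 2 3 4 _ rfl rfl rfl, h 0 2 1 3 4 _ rfl rfl rfl, h 0 3 1 2 4 _ rfl rfl rfl,
    h 0 4 1 2 3 _ rfl rfl rfl, h 1 2 0 3 4 _ rfl rfl rfl, h 1 3 0 2 4 _ rfl rfl rfl,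
    h 1 4 0 2 3 _ rfl rfl rfl, h 2 3 0 1 4 _ rfl rfl rfl, h 2 4 0 1 3 _ rfl rfl rfl,
    h 3 4 0 1 2 _ rfl rfl rfl]
  simp
  ring

end Bracket

/-! ### Connections and curvature with values in `𝔤₂`. -/

/-- The linear equations of `𝔤₂ ⊂ 𝔰𝔬(7)` for the matrix of a skew-symmetric operator. -/
structure IsG2 (A : Fin 7 → Fin 7 → ℝ) : Prop where
  skew : ∀ a b, A a b = - A b a
  -- The `m`-th equation contracts `A` with `φ(e_m, ·, ·)`: together they kill the 7-dimensional
  -- summand of `Λ² = Λ²₇ ⊕ 𝔤₂`.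
  eq0 : A 1 6 + A 2 4 - A 3 5 = 0
  eq1 : -A 0 6 - A 2 5 - A 3 4 = 0
  eq2 : -A 0 4 + A 1 5 + A 3 6 = 0
  eq3 : A 0 5 + A 1 4 - A 2 6 = 0
  eq4 : A 0 2 - A 1 3 + A 5 6 = 0
  eq5 : -A 0 3 - A 1 2 - A 4 6 = 0
  eq6 : A 0 1 + A 2 3 + A 4 5 = 0

/-- The torsion of a `G₂`-connection is determined by `dφ` and `d*φ`: a skew-symmetric,
torsion-free connection with `dφ = 0` and `d*φ = 0` takes values in `𝔤₂`. -/
theorem isG2_of_closed_of_coclosed {G C : Fin 7 → Fin 7 → Fin 7 → ℝ}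
    (hG : ∀ x a b, G x a b = - G x b a) (hC : ∀ x y z, C x y z = G x y z - G y x z)
    (h4 : ∀ a b c d : Fin 7, - (crossSign c d * C a b (crossIdx c d))
      + crossSign b d * C a c (crossIdx b d) - crossSign b c * C a d (crossIdx b c)
      - crossSign a d * C b c (crossIdx a d) + crossSign a c * C b d (crossIdx a c)
      - crossSign a b * C c d (crossIdx a b) = 0)
    (h5 : ∀ a b c d f : Fin 7, a < b → b < c → c < d → d < f →
      crossSign d f * crossSign (crossIdx d f) c * C a b (crossIdx (crossIdx d f) c)
      - crossSign d f * crossSign (crossIdx d f) b * C a c (crossIdx (crossIdx d f) b)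
      + crossSign c f * crossSign (crossIdx c f) b * C a d (crossIdx (crossIdx c f) b)
      - crossSign c d * crossSign (crossIdx c d) b * C a f (crossIdx (crossIdx c d) b)
      + crossSign d f * crossSign (crossIdx d f) a * C b c (crossIdx (crossIdx d f) a)
      - crossSign c f * crossSign (crossIdx c f) a * C b d (crossIdx (crossIdx c f) a)
      + crossSign c d * crossSign (crossIdx c d) a * C b f (crossIdx (crossIdx c d) a)
      + crossSign b f * crossSign (crossIdx b f) a * C c d (crossIdx (crossIdx b f) a)
      - crossSign b d * crossSign (crossIdx b d) a * C c f (crossIdx (crossIdx b d) a)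
      + crossSign b c * crossSign (crossIdx b c) a * C d f (crossIdx (crossIdx b c) a) = 0)
    (x : Fin 7) : IsG2 (G x) := by
  -- The condition `b < a` makes skewness a terminating rewrite rule.
  have hlow : ∀ x a b, b < a → G x a b = - G x b a := fun x a b _ => hG x a b
  have hdiag : ∀ x a, G x a a = 0 := fun x a => by linarith [hG x a a]
  have h0123 := h4 0 1 2 3
  have h0124 := h4 0 1 2 4
  have h0125 := h4 0 1 2 5
  have h0126 := h4 0 1 2 6
  have h0134 := h4 0 1 3 4
  have h0135 := h4 0 1 3 5
  have h0136 := h4 0 1 3 6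
  have h0145 := h4 0 1 4 5
  have h0146 := h4 0 1 4 6
  have h0156 := h4 0 1 5 6
  have h0234 := h4 0 2 3 4
  have h0235 := h4 0 2 3 5
  have h0236 := h4 0 2 3 6
  have h0245 := h4 0 2 4 5
  have h0246 := h4 0 2 4 6
  have h0256 := h4 0 2 5 6
  have h0345 := h4 0 3 4 5
  have h0346 := h4 0 3 4 6
  have h0356 := h4 0 3 5 6
  have h0456 := h4 0 4 5 6
  have h1234 := h4 1 2 3 4
  have h1235 := h4 1 2 3 5
  have h1236 := h4 1 2 3 6
  have h1245 := h4 1 2 4 5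
  have h1246 := h4 1 2 4 6
  have h1256 := h4 1 2 5 6
  have h1345 := h4 1 3 4 5
  have h1346 := h4 1 3 4 6
  have h1356 := h4 1 3 5 6
  have h1456 := h4 1 4 5 6
  have h2345 := h4 2 3 4 5
  have h2346 := h4 2 3 4 6
  have h2356 := h4 2 3 5 6
  have h2456 := h4 2 4 5 6
  have h3456 := h4 3 4 5 6
  have h01234 := h5 0 1 2 3 4 (by decide) (by decide) (by decide) (by decide)
  have h01235 := h5 0 1 2 3 5 (by decide) (by decide) (by decide) (by decide)
  have h01236 := h5 0 1 2 3 6 (by decide) (by decide) (by decide) (by decide)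
  have h01245 := h5 0 1 2 4 5 (by decide) (by decide) (by decide) (by decide)
  have h01246 := h5 0 1 2 4 6 (by decide) (by decide) (by decide) (by decide)
  have h01256 := h5 0 1 2 5 6 (by decide) (by decide) (by decide) (by decide)
  have h01345 := h5 0 1 3 4 5 (by decide) (by decide) (by decide) (by decide)
  have h01346 := h5 0 1 3 4 6 (by decide) (by decide) (by decide) (by decide)
  have h01356 := h5 0 1 3 5 6 (by decide) (by decide) (by decide) (by decide)
  have h01456 := h5 0 1 4 5 6 (by decide) (by decide) (by decide) (by decide)
  have h02345 := h5 0 2 3 4 5 (by decide) (by decide) (by decide) (by decide)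
  have h02346 := h5 0 2 3 4 6 (by decide) (by decide) (by decide) (by decide)
  have h02356 := h5 0 2 3 5 6 (by decide) (by decide) (by decide) (by decide)
  have h02456 := h5 0 2 4 5 6 (by decide) (by decide) (by decide) (by decide)
  have h03456 := h5 0 3 4 5 6 (by decide) (by decide) (by decide) (by decide)
  have h12345 := h5 1 2 3 4 5 (by decide) (by decide) (by decide) (by decide)
  have h12346 := h5 1 2 3 4 6 (by decide) (by decide) (by decide) (by decide)
  have h12356 := h5 1 2 3 5 6 (by decide) (by decide) (by decide) (by decide)
  have h12456 := h5 1 2 4 5 6 (by decide) (by decide) (by decide) (by decide)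
  have h13456 := h5 1 3 4 5 6 (by decide) (by decide) (by decide) (by decide)
  have h23456 := h5 2 3 4 5 6 (by decide) (by decide) (by decide) (by decide)
  simp [crossSign, crossIdx, hC, hlow, hdiag] at h0123 h0124 h0125 h0126 h0134 h0135 h0136 h0145 h0146
  simp [crossSign, crossIdx, hC, hlow, hdiag] at h0156 h0234 h0235 h0236 h0245 h0246 h0256 h0345 h0346
  simp [crossSign, crossIdx, hC, hlow, hdiag] at h0356 h0456 h1234 h1235 h1236 h1245 h1246 h1256 h1345
  simp [crossSign, crossIdx, hC, hlow, hdiag] at h1346 h1356 h1456 h2345 h2346 h2356 h2456 h3456 h01234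
  simp [crossSign, crossIdx, hC, hlow, hdiag] at h01235 h01236 h01245 h01246 h01256 h01345 h01346
  simp [crossSign, crossIdx, hC, hlow, hdiag] at h01356 h01456 h02345 h02346 h02356 h02456 h03456
  simp [crossSign, crossIdx, hC, hlow, hdiag] at h12345 h12346 h12356 h12456 h13456 h23456
  -- The 49 torsion components are recovered from the 35 equations of `dφ` and 21 of `d*φ`. Equation
  -- `x` of `G x` uses one fixed set of seven closedness equations; each other one combines two
  -- closedness equations with one coclosedness equation.
  fin_cases x
  · change IsG2 (G 0)
    exact ⟨hG _, by linarith only [h0123, h0145, h0256, h0346, h1246, h1356, h2345],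
      by linarith only [h0246, h0356, h23456],
      by linarith only [h0146, h0345, h13456],
      by linarith only [h0156, h0245, h12456],
      by linarith only [h0126, h0235, h12356],
      by linarith only [h0136, h0234, h12346],
      by linarith only [h0124, h0135, h12345]⟩
  · change IsG2 (G 1)
    exact ⟨hG _, by linarith only [h1256, h1346, h23456],
      by linarith only [h0123, h0145, h0256, h0346, h1246, h1356, h2345],
      by linarith only [h0156, h1345, h03456],
      by linarith only [h0146, h1245, h02456],
      by linarith only [h0136, h1235, h02356],
      by linarith only [h0126, h1234, h02346],
      by linarith only [h0125, h0134, h02345]⟩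
  · change IsG2 (G 2)
    exact ⟨hG _, by linarith only [h1245, h2346, h13456],
      by linarith only [h0245, h2356, h03456],
      by linarith only [h0123, h0145, h0256, h0346, h1246, h1356, h2345],
      by linarith only [h0246, h1256, h01456],
      by linarith only [h0125, h0236, h01356],
      by linarith only [h0124, h1236, h01346],
      by linarith only [h0234, h1235, h01345]⟩
  · change IsG2 (G 3)
    exact ⟨hG _, by linarith only [h1345, h2356, h12456],
      by linarith only [h0345, h2346, h02456],
      by linarith only [h0356, h1346, h01456],
      by linarith only [h0123, h0145, h0256, h0346, h1246, h1356, h2345],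
      by linarith only [h0135, h1236, h01256],
      by linarith only [h0134, h0236, h01246],
      by linarith only [h0235, h1234, h01245]⟩
  · change IsG2 (G 4)
    exact ⟨hG _, by linarith only [h1234, h2456, h12356],
      by linarith only [h0234, h3456, h02356],
      by linarith only [h0134, h0456, h01356],
      by linarith only [h0124, h1456, h01256],
      by linarith only [h0123, h0145, h0256, h0346, h1246, h1356, h2345],
      by linarith only [h0246, h1346, h01236],
      by linarith only [h0245, h1345, h01235]⟩
  · change IsG2 (G 5)
    exact ⟨hG _, by linarith only [h1235, h3456, h12346],
      by linarith only [h0235, h2456, h02346],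
      by linarith only [h0135, h1456, h01346],
      by linarith only [h0125, h0456, h01246],
      by linarith only [h0356, h1256, h01236],
      by linarith only [h0123, h0145, h0256, h0346, h1246, h1356, h2345],
      by linarith only [h0345, h1245, h01234]⟩
  · change IsG2 (G 6)
    exact ⟨hG _, by linarith only [h1236, h1456, h12345],
      by linarith only [h0236, h0456, h02345],
      by linarith only [h0136, h3456, h01345],
      by linarith only [h0126, h2456, h01245],
      by linarith only [h0156, h2356, h01235],
      by linarith only [h0146, h2346, h01234],
      by linarith only [h0123, h0145, h0256, h0346, h1246, h1356, h2345]⟩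

/-- `𝔤₂` is a Lie subalgebra. The order of factors reflects the convention `A a b = ⟪T e_a, e_b⟫`,
under which composition reverses matrix products. -/
theorem IsG2.commutator {A B : Fin 7 → Fin 7 → ℝ} (hA : IsG2 A) (hB : IsG2 B) :
    IsG2 fun a b => ∑ p, (B a p * A p b - A a p * B p b) := by
  refine ⟨fun a b => ?_, ?_, ?_, ?_, ?_, ?_, ?_, ?_⟩
  · rw [← Finset.sum_neg_distrib]
    refine Finset.sum_congr rfl fun p _ => ?_
    rw [hA.skew b p, hA.skew p a, hB.skew b p, hB.skew p a]
    ring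
  all_goals
    have hAlow : ∀ a b, b < a → A a b = - A b a := fun a b _ => hA.skew a b
    have hAdiag : ∀ a, A a a = 0 := fun a => by linarith [hA.skew a a]
    have hBlow : ∀ a b, b < a → B a b = - B b a := fun a b _ => hB.skew a b
    have hBdiag : ∀ a, B a a = 0 := fun a => by linarith [hB.skew a a]
    have hA0 : A 1 6 = -A 2 4 + A 3 5 := by linarith only [hA.eq0]
    have hA1 : A 0 6 = -A 2 5 - A 3 4 := by linarith only [hA.eq1]
    have hA2 : A 0 4 = A 1 5 + A 3 6 := by linarith only [hA.eq2]
    have hA3 : A 0 5 = -A 1 4 + A 2 6 := by linarith only [hA.eq3]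
    have hA4 : A 0 2 = A 1 3 - A 5 6 := by linarith only [hA.eq4]
    have hA5 : A 0 3 = -A 1 2 - A 4 6 := by linarith only [hA.eq5]
    have hA6 : A 0 1 = -A 2 3 - A 4 5 := by linarith only [hA.eq6]
    have hB0 : B 1 6 = -B 2 4 + B 3 5 := by linarith only [hB.eq0]
    have hB1 : B 0 6 = -B 2 5 - B 3 4 := by linarith only [hB.eq1]
    have hB2 : B 0 4 = B 1 5 + B 3 6 := by linarith only [hB.eq2]
    have hB3 : B 0 5 = -B 1 4 + B 2 6 := by linarith only [hB.eq3]
    have hB4 : B 0 2 = B 1 3 - B 5 6 := by linarith only [hB.eq4]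
    have hB5 : B 0 3 = -B 1 2 - B 4 6 := by linarith only [hB.eq5]
    have hB6 : B 0 1 = -B 2 3 - B 4 5 := by linarith only [hB.eq6]
    simp [Fin.sum_univ_seven, hAlow, hAdiag, hBlow, hBdiag, hA0, hA1, hA2, hA3, hA4, hA5, hA6, hB0, hB1, hB2, hB3, hB4, hB5, hB6]
    ring

theorem IsG2.sub {A B : Fin 7 → Fin 7 → ℝ} (hA : IsG2 A) (hB : IsG2 B) :
    IsG2 fun a b => A a b - B a b :=
  ⟨fun a b => by rw [hA.skew, hB.skew]; ring, by linarith only [hA.eq0, hB.eq0], by linarith only [hA.eq1, hB.eq1], by linarith only [hA.eq2, hB.eq2], by linarith only [hA.eq3, hB.eq3], by linarith only [hA.eq4, hB.eq4], by linarith only [hA.eq5, hB.eq5], by linarith only [hA.eq6, hB.eq6]⟩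

theorem IsG2.sum_mul {G : Fin 7 → Fin 7 → Fin 7 → ℝ} (hG : ∀ p, IsG2 (G p)) (c : Fin 7 → ℝ) :
    IsG2 fun a b => ∑ p, c p * G p a b := by
  refine ⟨fun a b => ?_, ?_, ?_, ?_, ?_, ?_, ?_, ?_⟩
  · rw [← Finset.sum_neg_distrib]
    exact Finset.sum_congr rfl fun p _ => by rw [(hG p).skew]; ring
  all_goals simp only [← Finset.sum_add_distrib, ← Finset.sum_sub_distrib, ← Finset.sum_neg_distrib]
  · exact Finset.sum_eq_zero fun p _ => by linear_combination c p * (hG p).eq0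
  · exact Finset.sum_eq_zero fun p _ => by linear_combination c p * (hG p).eq1
  · exact Finset.sum_eq_zero fun p _ => by linear_combination c p * (hG p).eq2
  · exact Finset.sum_eq_zero fun p _ => by linear_combination c p * (hG p).eq3
  · exact Finset.sum_eq_zero fun p _ => by linear_combination c p * (hG p).eq4
  · exact Finset.sum_eq_zero fun p _ => by linear_combination c p * (hG p).eq5
  · exact Finset.sum_eq_zero fun p _ => by linear_combination c p * (hG p).eq6

/-- An algebraic curvature tensor with values in `𝔤₂` has vanishing scalar curvature. -/
theorem sum_eq_zero_of_isG2 {r : Fin 7 → Fin 7 → Fin 7 → Fin 7 → ℝ}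
    (hr : ∀ x y a b, r x y a b = - r y x a b)
    (hb : ∀ x y z b, r x y z b + r y z x b + r z x y b = 0) (hG : ∀ x y, IsG2 (r x y)) :
    ∑ x, ∑ y, r x y y x = 0 := by
  have hlow : ∀ x y a b, y < x → r x y a b = - r y x a b := fun x y a b _ => hr x y a b
  have hlow' : ∀ x y a b, b < a → r x y a b = - r x y b a := fun x y a b _ => (hG x y).skew a b
  have hdiag : ∀ x a b, r x x a b = 0 := fun x a b => by linarith [hr x x a b]
  -- For each pair with `e_x × e_y = ± e_m`, equation `m` is used; the signed sum contracts the
  -- curvature with `∑ φ_{mxy} φ_{mab}`, that is, with metric terms and a `*φ` term.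
  have g16 := (hG 1 6).eq0
  have g24 := (hG 2 4).eq0
  have g35 := (hG 3 5).eq0
  have g06 := (hG 0 6).eq1
  have g25 := (hG 2 5).eq1
  have g34 := (hG 3 4).eq1
  have g04 := (hG 0 4).eq2
  have g15 := (hG 1 5).eq2
  have g36 := (hG 3 6).eq2
  have g05 := (hG 0 5).eq3
  have g14 := (hG 1 4).eq3
  have g26 := (hG 2 6).eq3
  have g02 := (hG 0 2).eq4
  have g13 := (hG 1 3).eq4
  have g56 := (hG 5 6).eq4
  have g03 := (hG 0 3).eq5
  have g12 := (hG 1 2).eq5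
  have g46 := (hG 4 6).eq5
  have g01 := (hG 0 1).eq6
  have g23 := (hG 2 3).eq6
  have g45 := (hG 4 5).eq6
  -- The Bianchi identities on the seven index quadruples of `*φ` cancel the `*φ` term, leaving the
  -- scalar curvature.
  have b3452 := hb 3 4 5 2
  have b2453 := hb 2 4 5 3
  have b2354 := hb 2 3 5 4
  have b2345 := hb 2 3 4 5
  have b1450 := hb 1 4 5 0
  have b0451 := hb 0 4 5 1
  have b0154 := hb 0 1 5 4
  have b0145 := hb 0 1 4 5
  have b1230 := hb 1 2 3 0
  have b0231 := hb 0 2 3 1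
  have b0132 := hb 0 1 3 2
  have b0123 := hb 0 1 2 3
  have b3561 := hb 3 5 6 1
  have b1563 := hb 1 5 6 3
  have b1365 := hb 1 3 6 5
  have b1356 := hb 1 3 5 6
  have b2461 := hb 2 4 6 1
  have b1462 := hb 1 4 6 2
  have b1264 := hb 1 2 6 4
  have b1246 := hb 1 2 4 6
  have b3460 := hb 3 4 6 0
  have b0463 := hb 0 4 6 3
  have b0364 := hb 0 3 6 4
  have b0346 := hb 0 3 4 6
  have b2560 := hb 2 5 6 0
  have b0562 := hb 0 5 6 2
  have b0265 := hb 0 2 6 5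
  have b0256 := hb 0 2 5 6
  simp [hlow, hlow'] at b3452 b2453 b2354 b2345 b1450 b0451 b0154 b0145 b1230 b0231 b0132 b0123 b3561
  simp [hlow, hlow'] at b1563 b1365 b1356 b2461 b1462 b1264 b1246 b3460 b0463 b0364 b0346 b2560 b0562
  simp [hlow, hlow'] at b0265 b0256
  simp [Fin.sum_univ_seven, hlow, hlow', hdiag]
  linarith only [g16, g24, g35, g06, g25, g34, g04, g15, g36, g05, g14, g26, g02, g13, g56, g03, g12,
      g46, g01, g23, g45, b3452, b2453, b2354, b2345, b1450, b0451, b0154, b0145, b1230,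
      b0231, b0132, b0123, b3561, b1563, b1365, b1356, b2461, b1462, b1264, b1246, b3460,
      b0463, b0364, b0346, b2560, b0562, b0265, b0256]

namespace Bracket

variable {μ : Bracket}

/-- A torsion-free `G₂`-structure has vanishing scalar curvature. -/
theorem scal_eq_zero_of_torsionFree (h4 : ∀ v, μ.d phi v = 0)
    (h5 : ∀ v, μ.d (star3 phi) v = 0) : μ.scal = 0 := by
  have hcoord : ∀ (x : E) k, x k = ⟪x, e k⟫_ℝ := fun x k => by
    rw [e, EuclideanSpace.inner_single_right]; simp
  set G : Fin 7 → Fin 7 → Fin 7 → ℝ := fun x a b => ⟪μ.nabla (e x) (e a), e b⟫_ℝ with hG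
  set C : Fin 7 → Fin 7 → Fin 7 → ℝ := fun x y z => ⟪μ.br (e x) (e y), e z⟫_ℝ with hC
  have hGG : ∀ x, IsG2 (G x) := by
    refine isG2_of_closed_of_coclosed (C := C) (fun x a b => ?_) (fun x y z => ?_)
      (fun a b c d => ?_) (fun a b c d f hab hbc hcd hdf => ?_)
    · simp only [hG]
      rw [inner_nabla_skew, real_inner_comm]
    · simp only [hG, hC]
      rw [← inner_sub_left, nabla_sub_nabla]
    · have := h4 ![e a, e b, e c, e d]
      rw [d_three] at this
      simp only [phi_apply_e, hcoord] at this
      exact this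
    · have := h5 ![e a, e b, e c, e d, e f]
      have hac := hab.trans hbc
      have had := hac.trans hcd
      have haf := had.trans hdf
      have hbd := hbc.trans hcd
      have hbf := hbd.trans hdf
      have hcf := hcd.trans hdf
      rw [d_four, star3_phi_apply_e _ hcd.ne hcf.ne, star3_phi_apply_e _ hbd.ne hbf.ne,
        star3_phi_apply_e _ hbc.ne hbf.ne, star3_phi_apply_e _ hbc.ne hbd.ne,
        star3_phi_apply_e _ had.ne haf.ne, star3_phi_apply_e _ hac.ne haf.ne,
        star3_phi_apply_e _ hac.ne had.ne, star3_phi_apply_e _ hab.ne haf.ne,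
        star3_phi_apply_e _ hab.ne had.ne, star3_phi_apply_e _ hab.ne hac.ne] at this
      simp only [hcoord] at this
      simp only [hC]
      linear_combination this
  have hexp : ∀ x, x = ∑ p, ⟪x, e p⟫_ℝ • e p := fun x => (sum_inner_smul_e x).symm
  have hnn : ∀ x y a b, ⟪μ.nabla (e x) (μ.nabla (e y) (e a)), e b⟫_ℝ = ∑ p, G y a p * G x p b := by
    intro x y a b
    rw [← nablaHom_apply, hexp (μ.nabla (e y) (e a))]
    simp only [map_sum, map_smul, sum_inner, real_inner_smul_left]
    rfl
  have hnb : ∀ x y a b, ⟪μ.nabla (μ.br (e x) (e y)) (e a), e b⟫_ℝ = ∑ p, C x y p * G p a b := by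
    intro x y a b
    rw [← nablaHom_apply, hexp (μ.br (e x) (e y))]
    simp only [map_sum, map_smul, LinearMap.sum_apply, LinearMap.smul_apply, sum_inner,
      real_inner_smul_left]
    rfl
  have hr : ∀ x y, IsG2 fun a b => ⟪μ.riem (e x) (e y) (e a), e b⟫_ℝ := by
    intro x y
    -- Curvature is a commutator of connection matrices minus a linear combination of them, so it
    -- stays in `𝔤₂`.
    have h := ((hGG x).commutator (hGG y)).sub (IsG2.sum_mul hGG (C x y))
    convert h using 3 with a b
    rw [riem, inner_sub_left, inner_sub_left, hnn, hnn, hnb, Finset.sum_sub_distrib]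
  have hbianchi : ∀ x y z, μ.riem x y z + μ.riem y z x + μ.riem z x y = 0 := by
    intro x y z
    have e1 := μ.nabla_sub_nabla x (μ.br y z)
    have e2 := μ.nabla_sub_nabla y (μ.br z x)
    have e3 := μ.nabla_sub_nabla z (μ.br x y)
    have hsub : ∀ a b c, μ.nabla a (b - c) = μ.nabla a b - μ.nabla a c := fun a b c =>
      map_sub (μ.nablaHom a) b c
    have hj : μ.br x (μ.br y z) + μ.br y (μ.br z x) + μ.br z (μ.br x y) = 0 := by
      rw [μ.jacobi x y z, μ.skew z (μ.br x y), μ.skew y (μ.br z x), μ.skew z x]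
      simp only [map_neg, LinearMap.neg_apply, neg_neg]
      rw [μ.skew y (μ.br x z)]
      abel
    rw [← e1, ← e2, ← e3] at hj
    rw [← hj]
    simp only [riem]
    have hn : ∀ a b c, μ.nabla a (μ.br b c) = μ.nabla a (μ.nabla b c) - μ.nabla a (μ.nabla c b) :=
      fun a b c => by rw [← hsub, nabla_sub_nabla]
    rw [hn x y z, hn y z x, hn z x y]
    abel
  have hskew : ∀ x y z, μ.riem x y z = - μ.riem y x z := fun x y z => by
    have : μ.nabla (μ.br x y) z = - μ.nabla (μ.br y x) z := by
      rw [μ.skew x y, ← nablaHom_apply, map_neg]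
      rfl
    simp only [riem, this]
    abel
  have hfinal := sum_eq_zero_of_isG2 (r := fun x y a b => ⟪μ.riem (e x) (e y) (e a), e b⟫_ℝ)
    (fun x y a b => by rw [hskew, inner_neg_left])
    (fun x y z b => by rw [← inner_add_left, ← inner_add_left, hbianchi, inner_zero_left]) hr
  rw [← hfinal]
  simp only [scal, ric]
  rw [Finset.sum_comm]

end Bracket

/-! ### Uniform estimate on the orbit and conclusion. -/

theorem exists_normSq_le_scal {μ : Bracket} (hμ : μ ∈ realType) :
    ∃ K : ℝ, 0 < K ∧ ∀ ν ∈ μ.orbit, ν ∈ solvable → ν.normSq ≤ K * - ν.scal := by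
  obtain ⟨C, hC0, hC⟩ := Bracket.exists_trace_bound hμ
  refine ⟨4 + 8 * C, by positivity, ?_⟩
  rintro _ ⟨h, rfl⟩ hs
  exact Bracket.normSq_le_scal hs hC0 (Bracket.TraceBound.act (μ := μ) hC h)

theorem normSq_pos_of_mem_orbit {μ ν : Bracket} (hμ : ¬ IsLieAbelian μ.Alg)
    (hν : ν ∈ μ.orbit) : 0 < ν.normSq := by
  by_contra! hn
  obtain ⟨h, rfl⟩ := hν
  refine hμ (μ.isLieAbelian_iff.2 fun x y => ?_)
  have h0 := (μ.act h).br_eq_zero_of_normSq_nonpos hn (h x) (h y)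
  simpa [Bracket.act] using h0

theorem mem_orbit_self (μ : Bracket) : μ ∈ μ.orbit := ⟨LinearEquiv.refl ℝ E, rfl⟩

end ClosedG2

end

theorem mainTheorem1 (μ : ClosedG2.Bracket)
    (hclosed : μ ∈ ClosedG2.closedG2) (hreal : μ ∈ ClosedG2.realType)
    (hnonabelian : ¬ IsLieAbelian μ.Alg) :
    (ClosedG2.pinchingValues μ).Nonempty ∧ 0 < ClosedG2.nInf μ := by
  open ClosedG2 in
  obtain ⟨K, hK, hbound⟩ := exists_normSq_le_scal hreal
  have hne : (pinchingValues μ).Nonempty := by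
    -- The witness is `μ` itself: were it torsion-free, `scal = 0` would force its norm to vanish.
    refine ⟨μ.F, μ, ⟨⟨mem_orbit_self μ, hclosed⟩, fun ⟨hs, h4, h5⟩ => ?_⟩, rfl⟩
    have h0 := hbound μ (mem_orbit_self μ) hs
    rw [Bracket.scal_eq_zero_of_torsionFree h4 h5, neg_zero, mul_zero] at h0
    exact (normSq_pos_of_mem_orbit hnonabelian (mem_orbit_self μ)).not_ge h0
  refine ⟨hne, lt_of_lt_of_le (b := 1 / (49 * 140000 ^ 2 * K ^ 2)) (by positivity)
    (le_csInf hne ?_)⟩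
  rintro _ ⟨ν, ⟨⟨hν, hνc⟩, -⟩, rfl⟩
  exact Bracket.le_F (normSq_pos_of_mem_orbit hnonabelian hν) hK (hbound ν hν hνc.1)
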